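/- Let $n\ge 2$ be even, let $(M,g)$ be a smooth Riemannian manifold of dimension $n$, and let $g_+=r^{-2}(dr^2+g_r)$ be a Poincaré–Einstein metric on $M\times(0,\varepsilon)$ with conformal infinity $[g]$ in normal form relative to $g$. That is, $g_r$ $(0<r<\varepsilon)$ is a smooth family of Riemannian metrics on $M$ with an expansion $$g_r = g + r^2 g_{(2)} + \dots + r^{n-2} g_{(n-2)} + r^n\big(g_{(n)}+\log r\;\bar g_{(n)}\big)+\cdots \qquad (r\to 0)$$ with smooth coefficients and $\operatorname{tr}_g\bar g_{(n)}=0$, the expansion holding up to $o(r^n)$ locally uniformly on $M$ and being differentiable term by term; moreover $\operatorname{Ric}(g_+)+n g_+=O(r^{n-2})$, and the $g$-trace of the $M$-tangential part of $\operatorname{Ric}(g_+)+n g_+$ is $o(r^{n-2})$. Let $v(r)=\mathrm{vol}(g_r)/\mathrm{vol}(g)$, a function on $M$ for each $r$. Let $T_{2N}(\lambda)$ $(2N\le n)$ be the operators on $C^\infty(M)$ which are the coefficients of the formal asymptotic expansion $$u\sim\sum_{N\ge 0} r^{\lambda+2N}\,T_{2N}(\lambda)(f),\qquad T_0(\lambda)(f)=f,\qquad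 r\to 0,$$ of solutions of $-\Delta_{g_+}u=\lambda(n-\lambda)u$: for every $f\in C^\infty(M)$, every $N$ with $2N\le n$ and every $\lambda\in\mathbb C\setminus\{\tfrac n2-1,\dots,\tfrac n2-N\}$, the partial sum $u_N=\sum_{j=0}^{N} r^{\lambda+2j}T_{2j}(\lambda)(f)$ satisfies $-\Delta_{g_+}u_N-\lambda(n-\lambda)u_N=o(r^{\lambda+2N})$ as $r\to0$. (Here $\Delta_{g_+}$ is the Laplace–Beltrami operator, with $-\Delta_{g_+}$ non-negative.) Then, for every $N\ge 0$ with $2N\le n$, the family of operators $$\Big(\lambda-\frac n2+1\Big)\cdots\Big(\lambda-\frac n2+N\Big)\,T_{2N}(\lambda)$$ is a polynomial in $\lambda$ of degree at most $N$ with coefficients in the linear operators on $C^\infty(M)$, and its coefficient of $\lambda^N$ is the operator of multiplication by the function $\big(v^{-1/2}\big)^{[2N]}$ on $M$, the coefficient of $r^{2N}$ in the Taylor expansion of $v(r)^{-1/2}$ at $r=0$. -/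

import Mathlib

open scoped Manifold ContDiff Topology
open Filter Asymptotics

noncomputable section

namespace PoincareEinstein

/-! ### Riemannian geometry in coordinates

`V` is the coordinate space, `b : ι → V` its coordinate frame, and `G : V → Matrix ι ι ℝ` the matrix
of components of a metric. -/

section Coordinates

variable {V : Type*} [NormedAddCommGroup V] [NormedSpace ℝ V]
variable {ι : Type*} [Fintype ι] [DecidableEq ι]

/-- The partial derivative of `u` in the direction of the `i`-th coordinate vector. -/
def partialDeriv {F : Type*} [NormedAddCommGroup F] [NormedSpace ℝ F]
    (b : ι → V) (i : ι) (u : V → F) (p : V) : F :=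
  fderiv ℝ u p (b i)

/-- The Christoffel symbol `Γ^k_{ij} = ½ G^{kl} (∂_i G_{jl} + ∂_j G_{il} - ∂_l G_{ij})`. -/
def christoffel (b : ι → V) (G : V → Matrix ι ι ℝ) (k i j : ι) (p : V) : ℝ :=
  (1 / 2) * ∑ l, (G p)⁻¹ k l *
    (partialDeriv b i (fun q => G q j l) p + partialDeriv b j (fun q => G q i l) p
      - partialDeriv b l (fun q => G q i j) p)

/-- The Ricci tensor
`Ric_{ij} = ∂_k Γ^k_{ij} - ∂_j Γ^k_{ik} + Γ^k_{kl} Γ^l_{ij} - Γ^k_{jl} Γ^l_{ik}`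
(positive on round spheres). -/
def ricci (b : ι → V) (G : V → Matrix ι ι ℝ) (p : V) : Matrix ι ι ℝ :=
  Matrix.of fun i j =>
    (∑ k, (partialDeriv b k (christoffel b G k i j) p
        - partialDeriv b j (christoffel b G k i k) p))
    + ∑ k, ∑ l, (christoffel b G k k l p * christoffel b G l i j p
        - christoffel b G k j l p * christoffel b G l i k p)

/-- The Laplace-Beltrami operator
`Δ u = (det G)^{-1/2} ∂_i ((det G)^{1/2} G^{ij} ∂_j u)` on complex-valued functions;
`-Δ` is non-negative. -/
def laplaceBeltrami (b : ι → V) (G : V → Matrix ι ι ℝ) (u : V → ℂ) (p : V) : ℂ :=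
  (Real.sqrt (G p).det)⁻¹ •
    ∑ i, partialDeriv b i
      (fun q => ∑ j, (Real.sqrt (G q).det * (G q)⁻¹ i j) • partialDeriv b j u q) p

end Coordinates

/-! ### Tensors on a manifold -/

section Manifold

variable (n : ℕ) (M : Type*) [TopologicalSpace M] [ChartedSpace (EuclideanSpace ℝ (Fin n)) M]

/-- Covariant 2-tensor fields on `M` (no regularity). -/
abbrev CovTwoTensor : Type _ :=
  ∀ x : M, TangentSpace (𝓡 n) x →L[ℝ] TangentSpace (𝓡 n) x →L[ℝ] ℝ

/-- The smooth complex-valued functions on `M`. -/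
def SmoothFunctions : Submodule ℂ (M → ℂ) where
  carrier := {f | ContMDiff (𝓡 n) 𝓘(ℝ, ℂ) ∞ f}
  add_mem' hf hg := ContMDiff.add hf hg
  zero_mem' := contMDiff_const
  smul_mem' c f hf := by
    have h : ContMDiff 𝓘(ℝ, ℂ) 𝓘(ℝ, ℂ) ∞ (fun z : ℂ => c • z) :=
      (contDiff_const_smul c).contMDiff
    exact h.comp hf

variable {n M}

/-- The matrix of components of a tensor field in the chart `e`, at the point of `M` with
coordinates `y`: the `(i, j)` entry is `h(∂_i, ∂_j)`. -/
def chartMatrix (e : OpenPartialHomeomorph M (EuclideanSpace ℝ (Fin n))) (h : CovTwoTensor n M)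
    (y : EuclideanSpace ℝ (Fin n)) : Matrix (Fin n) (Fin n) ℝ :=
  Matrix.of fun i j =>
    h (e.symm y) (mfderiv (𝓡 n) (𝓡 n) e.symm y (EuclideanSpace.single i (1 : ℝ)))
      (mfderiv (𝓡 n) (𝓡 n) e.symm y (EuclideanSpace.single j (1 : ℝ)))

/-- Smoothness of a covariant 2-tensor field: smoothness of its components in all charts. -/
def IsSmoothTensor (h : CovTwoTensor n M) : Prop :=
  ∀ e ∈ atlas (EuclideanSpace ℝ (Fin n)) M, ∀ i j,
    ContDiffOn ℝ ∞ (fun y => chartMatrix e h y i j) e.target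

/-- The coordinate frame `∂_1, …, ∂_n, ∂_r` on `ℝⁿ × ℝ`. -/
def productFrame (n : ℕ) : Fin n ⊕ Unit → EuclideanSpace ℝ (Fin n) × ℝ :=
  Sum.elim (fun i => (EuclideanSpace.single i 1, 0)) (fun _ => (0, 1))

/-- The components, at the point with coordinates `p = (y, r)`, of the metric
`g₊ = r⁻² (dr² + g_r)`, where `h r = g_r`. -/
def plusMatrix (e : OpenPartialHomeomorph M (EuclideanSpace ℝ (Fin n))) (h : ℝ → CovTwoTensor n M)
    (p : EuclideanSpace ℝ (Fin n) × ℝ) : Matrix (Fin n ⊕ Unit) (Fin n ⊕ Unit) ℝ :=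
  (p.2 ^ 2)⁻¹ • Matrix.fromBlocks (chartMatrix e (h p.2) p.1) 0 0 1

/-- The components of `Ric(g₊) + n g₊`, where `g₊ = r⁻² (dr² + h r)`. -/
def einsteinMatrix (e : OpenPartialHomeomorph M (EuclideanSpace ℝ (Fin n)))
    (h : ℝ → CovTwoTensor n M) (p : EuclideanSpace ℝ (Fin n) × ℝ) :
    Matrix (Fin n ⊕ Unit) (Fin n ⊕ Unit) ℝ :=
  ricci (productFrame n) (plusMatrix e h) p + (n : ℝ) • plusMatrix e h p

variable [IsManifold (𝓡 n) ∞ M]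

/-- A Poincaré-Einstein metric `g₊ = r⁻² (dr² + g_r)` on `M × (0, ε)` with conformal infinity `[g]`,
in normal form relative to `g`, where `dim M = n` is even and
`g_r = g + r² g₍₂₎ + ⋯ + r^{n-2} g₍ₙ₋₂₎ + r^n (g₍ₙ₎ + log r · ḡ₍ₙ₎) + ⋯`. -/
structure PoincareEinsteinMetric
    (g : Bundle.ContMDiffRiemannianMetric (𝓡 n) ∞ (EuclideanSpace ℝ (Fin n))
      (TangentSpace (𝓡 n) : M → Type)) where
  /-- The length of the collar. -/
  ε : ℝ
  ε_pos : 0 < ε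
  /-- The metrics `g_r` on `M`, for `0 < r < ε`. -/
  metric : ℝ → CovTwoTensor n M
  metric_symm : ∀ r ∈ Set.Ioo 0 ε, ∀ x v w, metric r x v w = metric r x w v
  metric_pos : ∀ r ∈ Set.Ioo 0 ε, ∀ x v, v ≠ 0 → 0 < metric r x v v
  /-- `g_r` is smooth on `M × (0, ε)`. -/
  metric_smooth : ∀ e ∈ atlas (EuclideanSpace ℝ (Fin n)) M, ∀ i j,
    ContDiffOn ℝ ∞ (fun p : EuclideanSpace ℝ (Fin n) × ℝ => chartMatrix e (metric p.2) p.1 i j)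
      (e.target ×ˢ Set.Ioo 0 ε)
  /-- The coefficients `coeff k = g₍₂ₖ₎`, for `2 k ≤ n`. -/
  coeff : ℕ → CovTwoTensor n M
  coeff_smooth : ∀ k, 2 * k ≤ n → IsSmoothTensor (coeff k)
  coeff_zero : coeff 0 = g.inner
  /-- The coefficient `ḡ₍ₙ₎` of `r^n log r`. -/
  logCoeff : CovTwoTensor n M
  logCoeff_smooth : IsSmoothTensor logCoeff
  /-- `ḡ₍ₙ₎` is trace-free with respect to `g`. -/
  logCoeff_traceFree : ∀ e ∈ atlas (EuclideanSpace ℝ (Fin n)) M, ∀ y ∈ e.target,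
    ((chartMatrix e g.inner y)⁻¹ * chartMatrix e logCoeff y).trace = 0
  /-- The expansion of `g_r` holds up to `o(r^n)`, may be differentiated term by term, and is
  locally uniform on `M`. -/
  expansion : ∀ e ∈ atlas (EuclideanSpace ℝ (Fin n)) M, ∀ y ∈ e.target, ∀ i j, ∀ m : ℕ,
    (fun p => iteratedFDeriv ℝ m
        (fun q : EuclideanSpace ℝ (Fin n) × ℝ =>
          chartMatrix e (metric q.2) q.1 i j
            - ∑ k ∈ Finset.range (n / 2 + 1), q.2 ^ (2 * k) * chartMatrix e (coeff k) q.1 i j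
            - q.2 ^ n * Real.log q.2 * chartMatrix e logCoeff q.1 i j) p)
      =o[𝓝 y ×ˢ 𝓝[>] 0] fun p => p.2 ^ ((n : ℤ) - m)
  /-- `Ric(g₊) + n g₊ = O(r^{n-2})`. -/
  einstein : ∀ e ∈ atlas (EuclideanSpace ℝ (Fin n)) M, ∀ y ∈ e.target, ∀ a c,
    (fun p => einsteinMatrix e metric p a c) =O[𝓝 y ×ˢ 𝓝[>] 0] fun p => p.2 ^ ((n : ℤ) - 2)
  /-- The trace condition: the tangential part of `r^{2-n} (Ric(g₊) + n g₊)` has vanishing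
  `g`-trace at `r = 0`. -/
  einstein_trace : ∀ e ∈ atlas (EuclideanSpace ℝ (Fin n)) M, ∀ y ∈ e.target,
    (fun p : EuclideanSpace ℝ (Fin n) × ℝ =>
        ((chartMatrix e g.inner p.1)⁻¹ * (einsteinMatrix e metric p).toBlocks₁₁).trace)
      =o[𝓝 y ×ˢ 𝓝[>] 0] fun p => p.2 ^ ((n : ℤ) - 2)

variable {g : Bundle.ContMDiffRiemannianMetric (𝓡 n) ∞ (EuclideanSpace ℝ (Fin n))
  (TangentSpace (𝓡 n) : M → Type)}

/-- The function `v(r) = vol(g_r) / vol(g)` on `M`. The quotient of the two densities does not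
depend on the chart around `x` used to compute it. -/
def PoincareEinsteinMetric.volumeRatio (P : PoincareEinsteinMetric g) (r : ℝ) (x : M) : ℝ :=
  Real.sqrt (chartMatrix (chartAt (EuclideanSpace ℝ (Fin n)) x) (P.metric r)
      (chartAt (EuclideanSpace ℝ (Fin n)) x x)).det /
    Real.sqrt (chartMatrix (chartAt (EuclideanSpace ℝ (Fin n)) x) g.inner
      (chartAt (EuclideanSpace ℝ (Fin n)) x x)).det

/-- `λ` is none of the points `n/2 - 1, …, n/2 - N`. -/
def IsRegularParameter (n N : ℕ) (lam : ℂ) : Prop :=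
  ∀ j ∈ Finset.Icc 1 N, lam ≠ (n : ℂ) / 2 - j

/-- The finite sum `∑_{j ≤ N} r^{λ+2j} a_j` as a function of the coordinates `p = (y, r)`. -/
def partialSum (e : OpenPartialHomeomorph M (EuclideanSpace ℝ (Fin n))) (lam : ℂ)
    (a : ℕ → M → ℂ) (N : ℕ) (p : EuclideanSpace ℝ (Fin n) × ℝ) : ℂ :=
  ∑ j ∈ Finset.range (N + 1), (p.2 : ℂ) ^ (lam + 2 * j) * a j (e.symm p.1)

/-- The operators `T N λ`, which stand for `T_{2N}(λ)`, are the coefficient operators of the formal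
asymptotic expansion `u ∼ ∑ r^{λ+2N} T_{2N}(λ) f`, `T_0(λ) f = f`, of solutions of
`-Δ_{g₊} u = λ (n - λ) u`: for `2N ≤ n` and `λ` outside of `{n/2 - 1, …, n/2 - N}`, the partial
sum up to `r^{λ+2N}` solves the equation up to `o(r^{λ+2N})`. -/
def PoincareEinsteinMetric.IsExpansionFamily (P : PoincareEinsteinMetric g)
    (T : ℕ → ℂ → SmoothFunctions n M → SmoothFunctions n M) : Prop :=
  (∀ lam f, T 0 lam f = f) ∧
  ∀ N, 2 * N ≤ n → ∀ lam, IsRegularParameter n N lam → ∀ f : SmoothFunctions n M,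
    ∀ e ∈ atlas (EuclideanSpace ℝ (Fin n)) M, ∀ y ∈ e.target,
      (fun r : ℝ =>
        - laplaceBeltrami (productFrame n) (plusMatrix e P.metric)
            (partialSum e lam (fun j => (T j lam f : M → ℂ)) N) (y, r)
          - lam * (n - lam) * partialSum e lam (fun j => (T j lam f : M → ℂ)) N (y, r))
        =o[𝓝[>] 0] fun r : ℝ => (r : ℂ) ^ (lam + 2 * N)

end Manifold

/-- `c` is the coefficient of `r^m` in the Taylor expansion of `φ(r)` as `r → 0+`. -/
def IsTaylorCoeff (φ : ℝ → ℝ) (m : ℕ) (c : ℝ) : Prop :=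
  ∃ p : Polynomial ℝ, (fun r => φ r - p.eval r) =o[𝓝[>] 0] (fun r : ℝ => r ^ m) ∧ p.coeff m = c

end PoincareEinstein

end

/-! For `g₊ = r⁻² (dr² + g_r)` the Laplacian sends `r^μ α` to `r^μ (r² Δ_{g_r} α + (μ (μ - n) + μ E
/ 2) α)`, where `E = r ∂_r log det g_r` (`laplaceBeltrami_powerSum`). With `μ = λ + 2j` one has `μ
(μ - n) + λ (n - λ) = 4j (λ - n/2 + j)`. Comparing coefficients of `r^{λ+2N}` in the eigenvalue
equation therefore gives, at each point, a recursion (`coeff_recursion_of_formal_solution`): `4N (λ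
- n/2 + N) T_{2N}(λ) f` is minus the sum over `j < N` of `(λ + 2j)/2 · c_{N-j} T_{2j}(λ) f +
D_{N-1-j} T_{2j}(λ) f`. Here `c_k` and `D_k` are the coefficients of `r^{2k}` in `E` and in
`Δ_{g_r}`, and they do not depend on `λ`.

The recursion makes sense up to `2N = n` although `g_r` contains `r^n log r`. The Laplacian of the
slice carries a factor `r²`, so it is needed only to order `r^{n-2}`. In `det g_r` the coefficient
of `r^n log r` is `det g · tr(g⁻¹ ḡ₍ₙ₎) = 0`, so `E` has a pure even expansion to order `r^n`
(`HasMetricJet.det_logJet`).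

After multiplication by `∏ (λ - n/2 + i)` the recursion produces, by induction, polynomials in `λ`
of degree at most `N`. Only the terms with the extra factor `λ + 2j` reach degree `N`, so the
leading coefficients satisfy `8N a_N = -∑ c_{N-j} a_j`, where the `D_k` no longer occur. With `X =
r²` this reads `8 X Q' = -E Q`; since `E = 2 X P'/P` for `P = det g_r / det g`, the solution with
`Q(0) = 1` is `P^{-1/4} = v^{-1/2}` (`coeff_recursion_of_fourth_root`).

The recursion holds pointwise, with the `D_k` known only as functionals. Operator coefficients are
recovered by Lagrange interpolation of the `T_{2N}` themselves, using that point evaluations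
separate smooth functions (`exists_operatorPolynomial`). -/

namespace PoincareEinstein

/-! ### Polynomials with operator coefficients, and the abstract recursion. -/

section OperatorPolynomials

open Polynomial

variable {S : Type*} [AddCommGroup S] [Module ℂ S]

/-- The scalar polynomial `∑ ℓ(p_k f) X^k` attached to a polynomial `∑ p_k X^k` with operator
coefficients, a functional `ℓ` and a vector `f`. -/
noncomputable def scalarPolynomial (p : (Module.End ℂ S)[X]) (ℓ : S →ₗ[ℂ] ℂ) (f : S) : ℂ[X] :=
  ∑ k ∈ Finset.range (p.natDegree + 1), monomial k (ℓ (p.coeff k f))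

theorem coeff_scalarPolynomial (p : (Module.End ℂ S)[X]) (ℓ : S →ₗ[ℂ] ℂ) (f : S) (k : ℕ) :
    (scalarPolynomial p ℓ f).coeff k = ℓ (p.coeff k f) := by
  simp only [scalarPolynomial, finsetSum_coeff, coeff_monomial]
  rw [Finset.sum_ite_eq' (Finset.range (p.natDegree + 1)) k fun j => ℓ (p.coeff j f)]
  split_ifs with h
  · rfl
  · rw [coeff_eq_zero_of_natDegree_lt (by simpa [Nat.lt_succ_iff] using h)]
    simp

theorem natDegree_scalarPolynomial_le (p : (Module.End ℂ S)[X]) (ℓ : S →ₗ[ℂ] ℂ) (f : S) :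
    (scalarPolynomial p ℓ f).natDegree ≤ p.natDegree := by
  rw [natDegree_le_iff_coeff_eq_zero]
  intro k hk
  rw [coeff_scalarPolynomial, coeff_eq_zero_of_natDegree_lt hk]
  simp

theorem eval_algebraMap_end_apply (p : (Module.End ℂ S)[X]) (lam : ℂ) (f : S) :
    p.eval (algebraMap ℂ _ lam) f
      = ∑ k ∈ Finset.range (p.natDegree + 1), lam ^ k • p.coeff k f := by
  rw [eval_eq_sum_range, LinearMap.sum_apply]
  refine Finset.sum_congr rfl fun k _ => ?_
  rw [← map_pow, Module.End.mul_apply, Module.algebraMap_end_apply, map_smul]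

theorem eval_scalarPolynomial (p : (Module.End ℂ S)[X]) (ℓ : S →ₗ[ℂ] ℂ) (f : S) (lam : ℂ) :
    (scalarPolynomial p ℓ f).eval lam = ℓ (p.eval (algebraMap ℂ _ lam) f) := by
  rw [eval_algebraMap_end_apply, map_sum, scalarPolynomial, eval_finsetSum]
  refine Finset.sum_congr rfl fun k _ => ?_
  rw [eval_monomial, map_smul, smul_eq_mul, mul_comm]

/-- Lagrange interpolation with operator values. -/
noncomputable def operatorInterpolation (N : ℕ) (ν : ℕ → ℂ) (B : ℕ → Module.End ℂ S) :
    (Module.End ℂ S)[X] :=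
  ∑ k ∈ Finset.range (N + 1),
    monomial k (∑ i ∈ Finset.range (N + 1), (Lagrange.basis (Finset.range (N + 1)) ν i).coeff k • B i)

theorem natDegree_operatorInterpolation_le (N : ℕ) (ν : ℕ → ℂ) (B : ℕ → Module.End ℂ S) :
    (operatorInterpolation N ν B).natDegree ≤ N := by
  refine natDegree_sum_le_of_forall_le _ _ fun k hk => (natDegree_monomial_le _).trans ?_
  have := Finset.mem_range.1 hk
  omega

/-- A scalar polynomial of degree at most `N` is determined by its values at `N + 1` distinct nodes,
and Lagrange interpolation commutes with the linear functional `f ↦ ℓ (· f)`. This reduces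
identities between operator polynomials to scalar ones. -/
theorem scalarPolynomial_operatorInterpolation {N : ℕ} {ν : ℕ → ℂ} (hν : Function.Injective ν)
    (B : ℕ → Module.End ℂ S) (ℓ : S →ₗ[ℂ] ℂ) (f : S) (s : ℂ[X]) (hs : s.natDegree ≤ N)
    (h : ∀ i, s.eval (ν i) = ℓ (B i f)) :
    scalarPolynomial (operatorInterpolation N ν B) ℓ f = s := by
  have hdeg : s.degree < (Finset.range (N + 1)).card := by
    rw [Finset.card_range]
    exact (degree_le_of_natDegree_le hs).trans_lt (by exact_mod_cast Nat.lt_succ_self N)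
  have hs' := Lagrange.eq_interpolate_of_eval_eq (fun i => ℓ (B i f)) (v := ν)
    hν.injOn hdeg (fun i _ => h i)
  ext k
  rw [coeff_scalarPolynomial]
  by_cases hk : k ≤ N
  · rw [hs', Lagrange.interpolate_apply, finsetSum_coeff, operatorInterpolation, finsetSum_coeff]
    simp only [coeff_monomial]
    rw [Finset.sum_ite_eq' (Finset.range (N + 1)) k, if_pos (by simpa [Nat.lt_succ_iff] using hk)]
    simp [mul_comm]
  · rw [coeff_eq_zero_of_natDegree_lt
      ((natDegree_operatorInterpolation_le N ν B).trans_lt (not_le.1 hk)),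
      coeff_eq_zero_of_natDegree_lt (hs.trans_lt (not_le.1 hk))]
    simp

/-- `λ ∉ {κ - 1, …, κ - N}`. -/
def IsRegularFor (κ : ℂ) (N : ℕ) (lam : ℂ) : Prop :=
  ∀ j ∈ Finset.Icc 1 N, lam ≠ κ - j

theorem IsRegularFor.mono {κ lam : ℂ} {N j : ℕ} (h : IsRegularFor κ N lam) (hj : j ≤ N) :
    IsRegularFor κ j lam := fun i hi =>
  h i (Finset.mem_Icc.2 ⟨(Finset.mem_Icc.1 hi).1, (Finset.mem_Icc.1 hi).2.trans hj⟩)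

theorem IsRegularFor.factor_ne_zero {κ lam : ℂ} {N : ℕ} (h : IsRegularFor κ N lam) (hN : 1 ≤ N) :
    4 * (N : ℂ) * (lam - κ + N) ≠ 0 := by
  refine mul_ne_zero (mul_ne_zero (by norm_num) (by exact_mod_cast (by omega : N ≠ 0))) fun h0 => ?_
  exact h N (Finset.mem_Icc.2 ⟨hN, le_rfl⟩) (by linear_combination h0)

/-- The points `κ, κ + 1, …` serve as interpolation nodes: they avoid every excluded value, all of
which lie at `κ - j` with `j ≥ 1`. -/
theorem isRegularFor_add_natCast (κ : ℂ) (N i : ℕ) : IsRegularFor κ N (κ + i) := by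
  intro j hj h
  have h1 : ((i + j : ℕ) : ℂ) = 0 := by push_cast; linear_combination h
  have h2 : i + j = 0 := by exact_mod_cast h1
  have := (Finset.mem_Icc.1 hj).1
  omega

/-- The two-term recursion satisfied, at the point `x`, by the coefficients of a formal solution. -/
def SatisfiesRecursion (κ : ℂ) (m : ℕ) (T : ℕ → ℂ → S → S) (ev : S →ₗ[ℂ] ℂ) (c : ℕ → ℂ)
    (D : ℕ → S →ₗ[ℂ] ℂ) : Prop :=
  ∀ N, 1 ≤ N → N ≤ m → ∀ lam, IsRegularFor κ N lam → ∀ f,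
    4 * (N : ℂ) * (lam - κ + N) * ev (T N lam f)
      = -∑ j ∈ Finset.range N, ((lam + 2 * j) / 2 * c (N - j) * ev (T j lam f)
          + D (N - 1 - j) (T j lam f))

/-- The maps `T N lam` are not assumed linear. The recursion expresses them, at regular `λ`, through
lower ones by linear functionals, so linearity propagates from `T 0 lam = id`. -/
theorem isLinearMap_of_recursion {X : Type*} {ev : X → S →ₗ[ℂ] ℂ}
    (hev : ∀ s t, (∀ x, ev x s = ev x t) → s = t) {κ : ℂ} {m : ℕ} {T : ℕ → ℂ → S → S}
    (h0 : ∀ lam f, T 0 lam f = f) {c : X → ℕ → ℂ} {D : X → ℕ → S →ₗ[ℂ] ℂ}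
    (hrec : ∀ x, SatisfiesRecursion κ m T (ev x) (c x) (D x)) (N : ℕ) (hN : N ≤ m) (lam : ℂ)
    (hlam : IsRegularFor κ N lam) : IsLinearMap ℂ (T N lam) := by
  induction N using Nat.strong_induction_on with
  | _ N ih =>
  rcases Nat.eq_zero_or_pos N with rfl | hpos
  · exact ⟨fun f f' => by simp [h0], fun a f => by simp [h0]⟩
  have ih' : ∀ j ∈ Finset.range N, IsLinearMap ℂ (T j lam) := fun j hj =>
    have hj := Finset.mem_range.1 hj
    ih j hj (by omega) (hlam.mono (by omega))
  refine ⟨fun f f' => hev _ _ fun x => mul_left_cancel₀ (hlam.factor_ne_zero hpos) ?_,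
    fun a f => hev _ _ fun x => mul_left_cancel₀ (hlam.factor_ne_zero hpos) ?_⟩
  · rw [map_add, mul_add (_ * _) (ev x _), hrec x N hpos hN lam hlam, hrec x N hpos hN lam hlam,
      hrec x N hpos hN lam hlam, ← neg_add, ← Finset.sum_add_distrib]
    refine congrArg _ (Finset.sum_congr rfl fun j hj => ?_)
    rw [(ih' j hj).map_add, map_add, map_add]
    ring
  · rw [map_smul, smul_eq_mul, mul_left_comm, hrec x N hpos hN lam hlam,
      hrec x N hpos hN lam hlam, ← neg_mul_eq_mul_neg, neg_mul_eq_mul_neg, mul_neg, Finset.mul_sum]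
    refine congrArg _ (Finset.sum_congr rfl fun j hj => ?_)
    rw [(ih' j hj).map_smul, map_smul, map_smul, smul_eq_mul, smul_eq_mul]
    ring

/-- The right-hand side of the recursion, multiplied by `∏ (λ - κ + i)`, as a polynomial in `λ`. -/
noncomputable def recursionPolynomial (κ : ℂ) (ev : S →ₗ[ℂ] ℂ) (c : ℕ → ℂ) (D : ℕ → S →ₗ[ℂ] ℂ)
    (p : ℕ → (Module.End ℂ S)[X]) (N : ℕ) (f : S) : ℂ[X] :=
  C (-(4 * (N : ℂ))⁻¹) * ∑ j ∈ Finset.range N,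
    (∏ i ∈ Finset.Ico (j + 1) N, (X + C (i - κ))) *
      (C (c (N - j) / 2) * ((X + C (2 * (j : ℂ))) * scalarPolynomial (p j) ev f)
        + scalarPolynomial (p j) (D (N - 1 - j)) f)

theorem natDegree_prod_X_add_C (κ : ℂ) (s : Finset ℕ) :
    (∏ i ∈ s, (X + C ((i : ℂ) - κ))).natDegree = s.card := by
  rw [natDegree_prod_of_monic _ _ fun i _ => monic_X_add_C _]
  simp only [natDegree_X_add_C, Finset.sum_const, smul_eq_mul, mul_one]

/-- The product has `N - 1 - j` factors, the linear factor adds one, and `q` adds at most `j`: the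
total is `N`. -/
theorem natDegree_recursion_summand_le {κ a b : ℂ} {N j : ℕ} (hj : j < N) {q q' : ℂ[X]}
    (hq : q.natDegree ≤ j) (hq' : q'.natDegree ≤ j) :
    ((∏ i ∈ Finset.Ico (j + 1) N, (X + C ((i : ℂ) - κ))) *
      (C a * ((X + C b) * q) + q')).natDegree ≤ N := by
  refine natDegree_mul_le.trans ?_
  rw [natDegree_prod_X_add_C, Nat.card_Ico]
  have : (C a * ((X + C b) * q) + q').natDegree ≤ j + 1 := by
    refine natDegree_add_le_of_degree_le ((natDegree_C_mul_le _ _).trans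
      (natDegree_mul_le.trans ?_)) (by omega)
    rw [natDegree_X_add_C]
    omega
  omega

/-- Top degree is reached only through `X + C b`; the summand `q'`, which will carry the Laplacian,
stays one degree below and drops out. -/
theorem coeff_recursion_summand {κ a b : ℂ} {N j : ℕ} (hj : j < N) {q q' : ℂ[X]}
    (hq : q.natDegree ≤ j) (hq' : q'.natDegree ≤ j) :
    ((∏ i ∈ Finset.Ico (j + 1) N, (X + C ((i : ℂ) - κ))) *
      (C a * ((X + C b) * q) + q')).coeff N = a * q.coeff j := by
  have h1 : (C a * ((X + C b) * q) + q').natDegree ≤ 1 + j := by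
    refine natDegree_add_le_of_degree_le ((natDegree_C_mul_le _ _).trans
      (natDegree_mul_le.trans ?_)) (by omega)
    rw [natDegree_X_add_C]
    omega
  have h2 : (∏ i ∈ Finset.Ico (j + 1) N, (X + C ((i : ℂ) - κ))).natDegree ≤ N - (j + 1) := by
    rw [natDegree_prod_X_add_C, Nat.card_Ico]
  have h3 : (∏ i ∈ Finset.Ico (j + 1) N, (X + C ((i : ℂ) - κ))).coeff (N - (j + 1)) = 1 := by
    have := (monic_prod_of_monic (Finset.Ico (j + 1) N) (fun i : ℕ => X + C ((i : ℂ) - κ))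
      fun i _ => monic_X_add_C _).coeff_natDegree
    rwa [natDegree_prod_X_add_C, Nat.card_Ico] at this
  conv_lhs => rw [show N = (N - (j + 1)) + (1 + j) by omega]
  have h4 := coeff_mul_add_eq_of_natDegree_le h2 h1
  simp only [show N - (j + 1) + (1 + j) = N by omega] at h4 ⊢
  rw [h4, h3, one_mul, coeff_add, coeff_C_mul,
    coeff_mul_add_eq_of_natDegree_le (natDegree_X_add_C b).le hq,
    coeff_eq_zero_of_natDegree_lt (p := q') (by omega)]
  simp

theorem natDegree_recursionPolynomial_le (κ : ℂ) (ev : S →ₗ[ℂ] ℂ) (c : ℕ → ℂ)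
    (D : ℕ → S →ₗ[ℂ] ℂ) (p : ℕ → (Module.End ℂ S)[X]) (N : ℕ) (f : S)
    (hp : ∀ j < N, (p j).natDegree ≤ j) :
    (recursionPolynomial κ ev c D p N f).natDegree ≤ N :=
  (natDegree_C_mul_le _ _).trans <| natDegree_sum_le_of_forall_le _ _ fun j hj =>
    have hj := Finset.mem_range.1 hj
    natDegree_recursion_summand_le hj ((natDegree_scalarPolynomial_le _ _ _).trans (hp j hj))
      ((natDegree_scalarPolynomial_le _ _ _).trans (hp j hj))

theorem coeff_recursionPolynomial (κ : ℂ) (ev : S →ₗ[ℂ] ℂ) (c : ℕ → ℂ)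
    (D : ℕ → S →ₗ[ℂ] ℂ) (p : ℕ → (Module.End ℂ S)[X]) {N : ℕ} (hN : 1 ≤ N) (f : S)
    (hp : ∀ j < N, (p j).natDegree ≤ j) :
    8 * (N : ℂ) * (recursionPolynomial κ ev c D p N f).coeff N
      = -∑ j ∈ Finset.range N, c (N - j) * ev ((p j).coeff j f) := by
  have hN0 : (N : ℂ) ≠ 0 := by exact_mod_cast (by omega : N ≠ 0)
  rw [recursionPolynomial, coeff_C_mul, finsetSum_coeff, Finset.mul_sum, Finset.mul_sum,
    ← Finset.sum_neg_distrib]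
  refine Finset.sum_congr rfl fun j hj => ?_
  have hj := Finset.mem_range.1 hj
  rw [coeff_recursion_summand hj ((natDegree_scalarPolynomial_le _ _ _).trans (hp j hj))
      ((natDegree_scalarPolynomial_le _ _ _).trans (hp j hj)), coeff_scalarPolynomial]
  field_simp
  ring

/-- The three factors have different roles: the last turns `T j` into the polynomial `p j`, the
middle one cancels the factor on the left of the recursion, and the first remains in
`recursionPolynomial`. -/
theorem prod_factor_split (κ lam : ℂ) {N j : ℕ} (hj : j < N) :
    ∏ i ∈ Finset.Icc 1 N, (lam - κ + i)
      = (∏ i ∈ Finset.Ico (j + 1) N, (lam + (i - κ))) * (lam - κ + N)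
        * ∏ i ∈ Finset.Icc 1 j, (lam - κ + i) := by
  have h1 : ∀ k, Finset.Icc 1 k = Finset.Ico 1 (k + 1) := fun k => by
    ext i; simp only [Finset.mem_Icc, Finset.mem_Ico]; omega
  rw [h1, h1, ← Finset.prod_Ico_consecutive _ (show 1 ≤ j + 1 by omega)
    (show j + 1 ≤ N + 1 by omega), Finset.prod_Ico_succ_top (show j + 1 ≤ N by omega), mul_comm]
  simp only [sub_add_eq_add_sub, add_sub_assoc]

theorem eval_recursionPolynomial {κ : ℂ} {m : ℕ} {T : ℕ → ℂ → S → S} {ev : S →ₗ[ℂ] ℂ} {c : ℕ → ℂ}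
    {D : ℕ → S →ₗ[ℂ] ℂ} (hrec : SatisfiesRecursion κ m T ev c D) {p : ℕ → (Module.End ℂ S)[X]}
    {N : ℕ} (hN : 1 ≤ N) (hNm : N ≤ m) {lam : ℂ} (hlam : IsRegularFor κ N lam) (f : S)
    (hp : ∀ j < N, (∏ i ∈ Finset.Icc 1 j, (lam - κ + i)) • T j lam f
      = (p j).eval (algebraMap ℂ _ lam) f) :
    (recursionPolynomial κ ev c D p N f).eval lam
      = (∏ i ∈ Finset.Icc 1 N, (lam - κ + i)) * ev (T N lam f) := by
  have hN0 : (N : ℂ) ≠ 0 := by exact_mod_cast (by omega : N ≠ 0)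
  refine mul_left_cancel₀ (hlam.factor_ne_zero hN) ?_
  rw [mul_left_comm, hrec N hN hNm lam hlam f, recursionPolynomial, eval_mul, eval_C,
    eval_finsetSum, ← Finset.sum_neg_distrib, Finset.mul_sum, Finset.mul_sum, Finset.mul_sum]
  refine Finset.sum_congr rfl fun j hj => ?_
  have hj := Finset.mem_range.1 hj
  rw [prod_factor_split κ lam hj]
  simp only [eval_mul, eval_add, eval_prod, eval_X, eval_C, eval_scalarPolynomial, ← hp j hj,
    map_smul, smul_eq_mul]
  field_simp

/-- At each point `x` the recursion makes `λ ↦ ∏ (λ - κ + i) · ev x (T N λ f)` a scalar polynomial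
of degree at most `N` on regular `λ`. The interpolating operator polynomial agrees with it at `N +
1` nodes, hence everywhere, and the functionals `ev x` separate vectors. -/
theorem exists_operatorPolynomial {X : Type*} {ev : X → S →ₗ[ℂ] ℂ}
    (hev : ∀ s t, (∀ x, ev x s = ev x t) → s = t) {κ : ℂ} {m : ℕ} {T : ℕ → ℂ → S → S}
    (h0 : ∀ lam f, T 0 lam f = f) {c : X → ℕ → ℂ} {D : X → ℕ → S →ₗ[ℂ] ℂ}
    (hrec : ∀ x, SatisfiesRecursion κ m T (ev x) (c x) (D x)) :
    ∃ p : ℕ → (Module.End ℂ S)[X], ∀ N ≤ m,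
      (p N).natDegree ≤ N ∧
      (∀ lam, IsRegularFor κ N lam → ∀ f, (∏ i ∈ Finset.Icc 1 N, (lam - κ + i)) • T N lam f
        = (p N).eval (algebraMap ℂ _ lam) f) ∧
      (N = 0 → ∀ f, (p N).coeff 0 f = f) ∧
      (1 ≤ N → ∀ x f, 8 * (N : ℂ) * ev x ((p N).coeff N f)
        = -∑ j ∈ Finset.range N, c x (N - j) * ev x ((p j).coeff j f)) := by
  classical
  set ν : ℕ → ℂ := fun i => κ + i with hν
  have hνinj : Function.Injective ν := fun i j hij => by simpa [hν] using hij
  have hlin : ∀ N, N ≤ m → ∀ i, IsLinearMap ℂ (T N (ν i)) := fun N hN i =>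
    isLinearMap_of_recursion hev h0 hrec N hN _ (isRegularFor_add_natCast κ N i)
  -- Linearity is available only for `N ≤ m`; beyond that the value is an irrelevant `0`.
  let B : ℕ → ℕ → Module.End ℂ S := fun N i =>
    if h : N ≤ m then (∏ j ∈ Finset.Icc 1 N, (ν i - κ + j)) • (hlin N h i).mk' else 0
  have hB : ∀ N, N ≤ m → ∀ i f,
      B N i f = (∏ j ∈ Finset.Icc 1 N, (ν i - κ + j)) • T N (ν i) f := fun N hN i f => by
    simp only [B, dif_pos hN]; rfl
  let p : ℕ → (Module.End ℂ S)[X] := fun N => operatorInterpolation N ν (B N)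
  have hpdeg : ∀ N, (p N).natDegree ≤ N := fun N => natDegree_operatorInterpolation_le N ν (B N)
  have key : ∀ N ≤ m, (∀ lam, IsRegularFor κ N lam → ∀ f,
      (∏ i ∈ Finset.Icc 1 N, (lam - κ + i)) • T N lam f = (p N).eval (algebraMap ℂ _ lam) f) ∧
      (1 ≤ N → ∀ x f, scalarPolynomial (p N) (ev x) f
        = recursionPolynomial κ (ev x) (c x) (D x) p N f) := by
    intro N hN
    induction N using Nat.strong_induction_on with
    | _ N ih =>
    rcases Nat.eq_zero_or_pos N with rfl | hpos
    · refine ⟨fun lam _ f => hev _ _ fun x => ?_, fun h => absurd h (by omega)⟩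
      rw [← eval_scalarPolynomial, scalarPolynomial_operatorInterpolation hνinj (B 0) (ev x) f
        (C (ev x f)) (by simp) (fun i => by rw [hB 0 hN]; simp [h0])]
      simp [h0]
    · have hs : ∀ x f, scalarPolynomial (p N) (ev x) f
          = recursionPolynomial κ (ev x) (c x) (D x) p N f := fun x f =>
        scalarPolynomial_operatorInterpolation hνinj (B N) (ev x) f _
          (natDegree_recursionPolynomial_le _ _ _ _ _ _ _ fun j _ => hpdeg j) fun i => by
            rw [hB N hN, map_smul, smul_eq_mul]
            exact eval_recursionPolynomial (hrec x) hpos hN (isRegularFor_add_natCast κ N i) f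
              fun j hj => (ih j hj (by omega)).1 _ (isRegularFor_add_natCast κ j i) f
      refine ⟨fun lam hlam f => hev _ _ fun x => ?_, fun _ => hs⟩
      rw [← eval_scalarPolynomial, hs, map_smul, smul_eq_mul]
      exact (eval_recursionPolynomial (hrec x) hpos hN hlam f
        fun j hj => (ih j hj (by omega)).1 _ (hlam.mono hj.le) f).symm
  refine ⟨p, fun N hN => ⟨hpdeg N, (key N hN).1, ?_, fun hpos x f => ?_⟩⟩
  · rintro rfl f
    refine hev _ _ fun x => ?_
    rw [← coeff_scalarPolynomial, scalarPolynomial_operatorInterpolation hνinj (B 0) (ev x) f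
      (C (ev x f)) (by simp) (fun i => by rw [hB 0 hN]; simp [h0])]
    simp
  · rw [← coeff_scalarPolynomial, (key N hN).2 hpos]
    exact coeff_recursionPolynomial _ _ _ _ _ hpos f fun j _ => hpdeg j

end OperatorPolynomials

/-! ### Asymptotic expansions in even powers of `r`. -/

section EvenJets

open Polynomial

variable {𝕜 : Type*} [RCLike 𝕜]

/-- `φ(r) = P(r²) + o(r^{2m})` as `r → 0+`. -/
def HasEvenJet (m : ℕ) (φ : ℝ → 𝕜) (P : 𝕜[X]) : Prop :=
  (fun r : ℝ => φ r - P.eval ((r : 𝕜) ^ 2)) =o[𝓝[>] 0] fun r : ℝ => r ^ (2 * m)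

theorem tendsto_eval_sq (P : 𝕜[X]) :
    Tendsto (fun r : ℝ => P.eval ((r : 𝕜) ^ 2)) (𝓝[>] 0) (𝓝 (P.coeff 0)) := by
  have h : Continuous fun r : ℝ => P.eval ((r : 𝕜) ^ 2) :=
    P.continuous.comp ((RCLike.continuous_ofReal).pow 2)
  have := (h.tendsto 0).mono_left (nhdsWithin_le_nhds (s := Set.Ioi 0))
  simpa [coeff_zero_eq_eval_zero] using this

theorem isBigO_pow_pow_nhdsGT {a b : ℕ} (h : b ≤ a) :
    (fun r : ℝ => r ^ a) =O[𝓝[>] 0] fun r : ℝ => r ^ b := by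
  rcases h.eq_or_lt with rfl | h
  · exact isBigO_refl _ _
  · exact ((isLittleO_pow_pow h).mono nhdsWithin_le_nhds).isBigO

namespace HasEvenJet

variable {m k : ℕ} {φ ψ : ℝ → 𝕜} {P Q : 𝕜[X]}

theorem congr' (h : HasEvenJet m φ P) (hφ : φ =ᶠ[𝓝[>] 0] ψ) : HasEvenJet m ψ P :=
  IsLittleO.congr' h (hφ.mono fun r hr => by simp only [hr]) EventuallyEq.rfl

theorem mono (h : HasEvenJet m φ P) (hk : k ≤ m) : HasEvenJet k φ P :=
  h.trans_isBigO (isBigO_pow_pow_nhdsGT (by omega))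

theorem of_eval (m : ℕ) (P : 𝕜[X]) : HasEvenJet m (fun r : ℝ => P.eval ((r : 𝕜) ^ 2)) P := by
  simp [HasEvenJet]

theorem const (m : ℕ) (a : 𝕜) : HasEvenJet m (fun _ => a) (C a) := by
  simp [HasEvenJet]

theorem of_isLittleO (h : φ =o[𝓝[>] 0] fun r : ℝ => r ^ (2 * m)) : HasEvenJet m φ 0 := by
  simpa [HasEvenJet] using h

theorem isLittleO (h : HasEvenJet m φ 0) : φ =o[𝓝[>] 0] fun r : ℝ => r ^ (2 * m) := by
  simpa [HasEvenJet] using h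

theorem add (hφ : HasEvenJet m φ P) (hψ : HasEvenJet m ψ Q) :
    HasEvenJet m (fun r => φ r + ψ r) (P + Q) :=
  (IsLittleO.add hφ hψ).congr_left fun r => by rw [eval_add]; ring

theorem neg (hφ : HasEvenJet m φ P) : HasEvenJet m (fun r => -φ r) (-P) :=
  (IsLittleO.neg_left hφ).congr_left fun r => by rw [eval_neg]; ring

theorem sub (hφ : HasEvenJet m φ P) (hψ : HasEvenJet m ψ Q) :
    HasEvenJet m (fun r => φ r - ψ r) (P - Q) := by
  simpa only [sub_eq_add_neg] using hφ.add hψ.neg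

theorem tendsto (h : HasEvenJet m φ P) : Tendsto φ (𝓝[>] 0) (𝓝 (P.coeff 0)) := by
  have h0 : Tendsto (fun r : ℝ => φ r - P.eval ((r : 𝕜) ^ 2)) (𝓝[>] 0) (𝓝 0) := by
    simpa [HasEvenJet] using h.mono (Nat.zero_le m)
  simpa using h0.add (tendsto_eval_sq P)

theorem mul (hφ : HasEvenJet m φ P) (hψ : HasEvenJet m ψ Q) :
    HasEvenJet m (fun r => φ r * ψ r) (P * Q) := by
  have h1 := hφ.tendsto.isBigO_one ℝ
  have h2 := (tendsto_eval_sq Q).isBigO_one ℝ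
  have h3 := (h1.mul_isLittleO hψ).add (h2.mul_isLittleO hφ)
  refine (h3.congr_left fun r => ?_).congr_right fun r => one_mul _
  rw [eval_mul]
  ring

theorem sum {ι : Type*} (s : Finset ι) {φ : ι → ℝ → 𝕜} {P : ι → 𝕜[X]}
    (h : ∀ i ∈ s, HasEvenJet m (φ i) (P i)) :
    HasEvenJet m (fun r => ∑ i ∈ s, φ i r) (∑ i ∈ s, P i) := by
  classical
  induction s using Finset.induction_on with
  | empty => simpa using const m (0 : 𝕜)
  | insert a s ha ih =>
    simp only [Finset.sum_insert ha]
    exact (h a (Finset.mem_insert_self a s)).add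
      (ih fun i hi => h i (Finset.mem_insert_of_mem hi))

theorem pow (h : HasEvenJet m φ P) (k : ℕ) : HasEvenJet m (fun r => φ r ^ k) (P ^ k) := by
  induction k with
  | zero => simpa using const m (1 : 𝕜)
  | succ k ih => simpa only [pow_succ] using ih.mul h

theorem pow_mul (h : HasEvenJet m φ P) (k : ℕ) :
    HasEvenJet m (fun r : ℝ => (r : 𝕜) ^ (2 * k) * φ r) (X ^ k * P) := by
  have h1 := of_eval m (X ^ k : 𝕜[X])
  simp only [eval_pow, eval_X, ← _root_.pow_mul] at h1
  exact h1.mul h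

theorem sq_mul_succ (h : HasEvenJet m φ P) :
    HasEvenJet (m + 1) (fun r : ℝ => (r : 𝕜) ^ 2 * φ r) (X * P) := by
  have h1 : (fun r : ℝ => (r : 𝕜) ^ 2) =O[𝓝[>] 0] fun r : ℝ => r ^ 2 :=
    IsBigO.of_norm_le fun r => by simp
  refine ((h1.mul_isLittleO h).congr_left fun r => ?_).congr_right fun r => by ring
  simp only [eval_mul, eval_X]
  ring

/-- This is uniqueness of expansions. The limit at `0` forces a zero constant term, so `P = X R`;
dividing the estimate by `r²` leaves one for `R` of order one less. -/
theorem X_pow_dvd (h : HasEvenJet m (fun _ => (0 : 𝕜)) P) : X ^ (m + 1) ∣ P := by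
  induction m generalizing P with
  | zero =>
    rw [zero_add, pow_one, X_dvd_iff]
    exact tendsto_nhds_unique h.tendsto tendsto_const_nhds
  | succ m ih =>
    obtain ⟨R, rfl⟩ := X_dvd_iff.2 (tendsto_nhds_unique h.tendsto tendsto_const_nhds)
    rw [pow_succ']
    refine mul_dvd_mul_left _ (ih ?_)
    have h1 : (fun r : ℝ => ((r ^ 2 : ℝ))⁻¹) =O[𝓝[>] 0] fun r : ℝ => (r ^ 2)⁻¹ := isBigO_refl _ _
    refine (h1.smul_isLittleO h).congr' ?_ ?_
    · filter_upwards [self_mem_nhdsWithin] with r hr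
      have hr : (r : 𝕜) ≠ 0 := by exact_mod_cast (ne_of_gt hr : r ≠ 0)
      rw [RCLike.real_smul_eq_coe_mul]
      simp only [eval_mul, eval_X, RCLike.ofReal_inv, RCLike.ofReal_pow]
      field_simp
      ring
    · filter_upwards [self_mem_nhdsWithin] with r hr
      have hr : r ≠ 0 := ne_of_gt hr
      rw [smul_eq_mul]
      field_simp
      ring

theorem X_pow_dvd_sub (h : HasEvenJet m φ P) (h' : HasEvenJet m φ Q) : X ^ (m + 1) ∣ P - Q :=
  X_pow_dvd (by simpa using h.sub h')

theorem coeff_eq (h : HasEvenJet m φ P) (h' : HasEvenJet m φ Q) (hk : k ≤ m) :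
    P.coeff k = Q.coeff k := by
  have := X_pow_dvd_iff.1 (h.X_pow_dvd_sub h') k (by omega)
  rwa [coeff_sub, sub_eq_zero] at this

/-- A polynomial with nonzero constant term is coprime to `X ^ (m + 1)`, and the Bézout coefficient
is its inverse modulo that power. -/
theorem exists_inv (h : HasEvenJet m φ P) (h0 : P.coeff 0 ≠ 0) :
    ∃ Q, HasEvenJet m (fun r => (φ r)⁻¹) Q := by
  have hcop : IsCoprime (X ^ (m + 1)) P :=
    (IsCoprime.pow_left ((prime_X.coprime_iff_not_dvd).2 (by rwa [X_dvd_iff])))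
  obtain ⟨b, Q, hQ⟩ := hcop
  refine ⟨Q, ?_⟩
  have h1 : HasEvenJet m (fun r => 1 - Q.eval ((r : 𝕜) ^ 2) * φ r) 0 := by
    have h2 := (const m (1 : 𝕜)).sub ((of_eval m Q).mul h)
    have h3 : HasEvenJet m (fun _ => (0 : 𝕜)) (b * X ^ (m + 1)) := by
      have h4 : HasEvenJet m (fun _ => (0 : 𝕜)) (X ^ (m + 1)) := by
        have h5 : (fun r : ℝ => (r : 𝕜) ^ (2 * (m + 1))) =o[𝓝[>] 0] fun r : ℝ => r ^ (2 * m) := by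
          refine IsBigO.trans_isLittleO (g := fun r : ℝ => r ^ (2 * (m + 1)))
            (IsBigO.of_norm_norm (IsBigO.of_norm_le fun r => by simp)) ?_
          exact (isLittleO_pow_pow (by omega)).mono nhdsWithin_le_nhds
        refine h5.neg_left.congr_left fun r => ?_
        rw [eval_pow, eval_X]
        ring
      simpa using (of_eval m b).mul h4
    have h6 := h2.sub h3
    rw [C_1, show (1 - Q * P - b * X ^ (m + 1) : 𝕜[X]) = 0 by rw [← hQ]; ring] at h6
    simpa using h6
  have h2 := ((h.tendsto.inv₀ h0).isBigO_one ℝ).mul_isLittleO h1.isLittleO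
  refine h2.congr' ?_ (Eventually.of_forall fun r => one_mul _)
  filter_upwards [h.tendsto.eventually_ne h0] with r hr
  field_simp

theorem ofReal {φ : ℝ → ℝ} {P : ℝ[X]} (h : HasEvenJet m φ P) :
    HasEvenJet m (fun r => (φ r : ℂ)) (P.map Complex.ofRealHom) := by
  refine IsLittleO.congr_left (IsLittleO.of_norm_left
    (f' := fun r : ℝ => ((φ r - P.eval (r ^ 2) : ℝ) : ℂ)) ?_) fun r => ?_
  · simp only [Complex.norm_real]
    exact IsLittleO.norm_left h
  · have : P.eval (r ^ 2) = P.eval₂ (RingHom.id ℝ) (r ^ 2) := rfl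
    rw [eval_map]
    have h2 := (Polynomial.hom_eval₂ P (RingHom.id ℝ) Complex.ofRealHom (r ^ 2))
    simp only [RingHom.comp_id] at h2
    rw [this, Complex.ofReal_sub]
    congr 1
    simpa using h2

theorem isBigO_sq (h : HasEvenJet m φ P) (hm : 1 ≤ m) (h0 : P.coeff 0 = 0) :
    φ =O[𝓝[>] 0] fun r : ℝ => r ^ 2 := by
  obtain ⟨R, rfl⟩ := X_dvd_iff.2 h0
  have h1 : (fun r : ℝ => (r : 𝕜) ^ 2) =O[𝓝[>] 0] fun r : ℝ => r ^ 2 :=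
    IsBigO.of_norm_le fun r => by simp
  have h2 : (fun r : ℝ => (X * R).eval ((r : 𝕜) ^ 2)) =O[𝓝[>] 0] fun r : ℝ => r ^ 2 := by
    simp only [eval_mul, eval_X]
    simpa using h1.mul ((tendsto_eval_sq R).isBigO_one ℝ)
  have h3 := (IsLittleO.isBigO h).trans (isBigO_pow_pow_nhdsGT (show 2 ≤ 2 * m by omega))
  exact (h3.add h2).congr_left fun r => by simp

/-- Since `φ - 1 = O(r²)`, the Taylor remainder `o((φ - 1)^m)` of `F` at `1` is already `o(r^{2m})`.
-/
theorem exists_comp {φ : ℝ → ℝ} {P : ℝ[X]} (h : HasEvenJet m φ P) (h0 : P.coeff 0 = 1)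
    {F : ℝ → ℝ} (hF : ContDiffOn ℝ m F (Set.Ioi 0)) :
    ∃ Q, HasEvenJet m (fun r => F (φ r)) Q := by
  have htaylor := taylor_isLittleO (convex_Ioi (0 : ℝ)) (Set.mem_Ioi.2 one_pos) hF
  rw [IsOpen.nhdsWithin_eq isOpen_Ioi (Set.mem_Ioi.2 one_pos)] at htaylor
  have htend : Tendsto φ (𝓝[>] 0) (𝓝 1) := h0 ▸ h.tendsto
  have h1 := htaylor.comp_tendsto htend
  have hu : HasEvenJet m (fun r => φ r - 1) (P - C 1) := h.sub (const m 1)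
  have hO : (fun r => (φ r - 1) ^ m) =O[𝓝[>] 0] fun r : ℝ => r ^ (2 * m) := by
    rcases Nat.eq_zero_or_pos m with rfl | hm
    · simpa using isBigO_refl (fun _ : ℝ => (1 : ℝ)) (𝓝[>] 0)
    have h2 := hu.isBigO_sq hm (by simp [h0])
    exact (h2.pow m).congr_right fun r => (_root_.pow_mul r 2 m).symm
  have h2 := h1.trans_isBigO hO
  have h3 : HasEvenJet m (fun r => taylorWithinEval F m (Set.Ioi 0) 1 (φ r))
      (∑ k ∈ Finset.range (m + 1),
        C (((k.factorial : ℝ)⁻¹) * iteratedDerivWithin k F (Set.Ioi 0) 1) * (P - C 1) ^ k) := by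
    have := sum (Finset.range (m + 1)) fun k _ =>
      (const m (((k.factorial : ℝ)⁻¹) * iteratedDerivWithin k F (Set.Ioi 0) 1)).mul (hu.pow k)
    refine this.congr' (Eventually.of_forall fun r => ?_)
    simp only [taylor_within_apply, smul_eq_mul]
    exact Finset.sum_congr rfl fun k _ => by ring
  refine ⟨_, ((of_isLittleO h2).add h3).congr' (Eventually.of_forall fun r => ?_)⟩
  simp

end HasEvenJet

theorem exists_rpow_jet {m : ℕ} {φ : ℝ → ℝ} {P : ℝ[X]} (h : HasEvenJet m φ P)
    (h0 : P.coeff 0 = 1) (a : ℝ) : ∃ Q, HasEvenJet m (fun r => φ r ^ a) Q :=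
  h.exists_comp h0 fun _ ht =>
    (Real.contDiffAt_rpow_const_of_ne (ne_of_gt ht)).contDiffWithinAt

/-- The power series `Q = P^{-1/4}` satisfies the recursion obtained from
`8 X Q' = - c Q`, where `c P = 2 X P'`. -/
theorem coeff_recursion_of_fourth_root {m : ℕ} {P Q c : ℝ[X]}
    (hQ : X ^ (m + 1) ∣ Q ^ 4 * P - 1) (hc : X ^ (m + 1) ∣ c * P - 2 * X * derivative P)
    {N : ℕ} (hN : 1 ≤ N) (hNm : N ≤ m) :
    8 * (N : ℝ) * Q.coeff N = -∑ j ∈ Finset.range N, c.coeff (N - j) * Q.coeff j := by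
  have hcop : ∀ R : ℝ[X], ¬ X ∣ R → ∀ A, X ^ (m + 1) ∣ R * A → X ^ (m + 1) ∣ A := fun R hR A hA =>
    (IsCoprime.pow_left ((prime_X.coprime_iff_not_dvd).2 hR)).dvd_of_dvd_mul_left hA
  have hX1 : ¬ (X : ℝ[X]) ∣ Q ^ 4 * P := fun h => by
    have h1 : (X : ℝ[X]) ∣ Q ^ 4 * P - 1 := (dvd_pow_self X (by omega)).trans hQ
    have h2 := (dvd_sub_right h).1 h1
    exact not_isUnit_X (isUnit_of_dvd_one h2)
  have hXQ : ¬ (X : ℝ[X]) ∣ Q := fun h => hX1 ((h.trans (dvd_pow_self Q (by omega))).mul_right P)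
  have hXP : ¬ (X : ℝ[X]) ∣ P := fun h => hX1 (h.mul_left _)
  -- Differentiating the congruence `Q ^ 4 * P ≡ 1` loses one power of `X`, which the factor `X`
  -- restores.
  have hder : X ^ (m + 1) ∣ X * (4 * Q ^ 3 * derivative Q * P + Q ^ 4 * derivative P) := by
    obtain ⟨R, hR⟩ := hQ
    have h1 := congrArg derivative hR
    simp only [derivative_sub, derivative_mul, derivative_pow, derivative_one,
      sub_zero] at h1
    refine ⟨C ((m : ℝ) + 1) * R + X * derivative R, ?_⟩
    simp only [Nat.cast_ofNat, Nat.add_one_sub_one, derivative_X, mul_one] at h1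
    have h2 : C (4 : ℝ) = (4 : ℝ[X]) := rfl
    rw [h2] at h1
    have h3 : X * (4 * Q ^ 3 * derivative Q * P + Q ^ 4 * derivative P)
        = X * (4 * Q ^ (4 - 1) * derivative Q * P + Q ^ 4 * derivative P) := by norm_num
    rw [h3, h1]
    push_cast
    simp only [map_add, map_natCast, map_one]
    ring
  -- `Q` and `P` have nonzero constant terms, so `Q ^ 3` here and `P` in the next step may be
  -- cancelled modulo `X ^ (m + 1)`.
  have h1 : X ^ (m + 1) ∣ X * (8 * derivative Q * P + 2 * Q * derivative P) := by
    refine hcop (Q ^ 3) (fun h => hXQ (prime_X.dvd_of_dvd_pow h)) _ ?_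
    have := hder.mul_left 2
    convert this using 1
    ring
  have h2 : X ^ (m + 1) ∣ 8 * X * derivative Q + c * Q := by
    refine hcop P hXP _ ?_
    have := h1.add (hc.mul_left Q)
    convert this using 1
    ring
  have h3 := X_pow_dvd_iff.1 h2 N (by omega)
  have hc0 : c.coeff 0 = 0 := by
    have h4 := X_pow_dvd_iff.1 hc 0 (by omega)
    have h5 : P.coeff 0 ≠ 0 := fun h => hXP (X_dvd_iff.2 h)
    simpa [mul_coeff_zero, h5] using h4
  obtain ⟨N, rfl⟩ : ∃ k, N = k + 1 := ⟨N - 1, by omega⟩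
  rw [coeff_add, mul_assoc, show (8 : ℝ[X]) = C 8 from rfl, coeff_C_mul, coeff_X_mul,
    coeff_derivative, mul_comm c Q, coeff_mul, Finset.Nat.sum_antidiagonal_eq_sum_range_succ_mk,
    Finset.sum_range_succ, Nat.sub_self, hc0] at h3
  have h6 : ∑ j ∈ Finset.range (N + 1), c.coeff (N + 1 - j) * Q.coeff j
      = ∑ j ∈ Finset.range (N + 1), Q.coeff j * c.coeff (N + 1 - j) :=
    Finset.sum_congr rfl fun j _ => mul_comm _ _
  rw [h6]
  push_cast
  linear_combination h3

end EvenJets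

/-! ### Expansions with an `r^{2m} log r` term, tracked by dual numbers. -/

section LogJets

open Polynomial DualNumber

theorem fst_algebraMap_dualNumber (a : ℝ) : (algebraMap ℝ ℝ[ε] a).fst = a := rfl

theorem snd_algebraMap_dualNumber (a : ℝ) : (algebraMap ℝ ℝ[ε] a).snd = 0 := rfl

/-- A logarithmic term interacts only with the constant term of the other factor: the deviation from
that constant is `O(r²)`, which makes the cross term `o(r^{2m+1})`, and `L₁ L₂ = o(r^{4m-2})` is
negligible because `m ≥ 1`. This is multiplication in the dual numbers. -/
theorem HasEvenJet.mul_log {m : ℕ} (hm : 1 ≤ m) {f g L₁ L₂ : ℝ → ℝ} {b₁ b₂ : ℝ} {P Q : ℝ[X]}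
    (hL₁ : L₁ =o[𝓝[>] 0] fun r : ℝ => r ^ (2 * m - 1))
    (hL₂ : L₂ =o[𝓝[>] 0] fun r : ℝ => r ^ (2 * m - 1))
    (hf : HasEvenJet m (fun r => f r - b₁ * L₁ r) P)
    (hg : HasEvenJet m (fun r => g r - b₂ * L₂ r) Q) :
    HasEvenJet m (fun r => f r * g r - (P.coeff 0 * b₂ * L₂ r + Q.coeff 0 * b₁ * L₁ r))
      (P * Q) := by
  have aux : ∀ {L h : ℝ → ℝ} {R : ℝ[X]}, L =o[𝓝[>] 0] (fun r : ℝ => r ^ (2 * m - 1)) →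
      HasEvenJet m h R → HasEvenJet m (fun r => L r * (h r - R.coeff 0)) 0 := by
    intro L h R hL hh
    refine HasEvenJet.of_isLittleO ((hL.mul_isBigO ((hh.sub (.const m (R.coeff 0))).isBigO_sq hm
      (by simp))).trans_isBigO ?_)
    refine IsBigO.congr_left (isBigO_pow_pow_nhdsGT (a := 2 * m + 1) (by omega)) fun r => ?_
    rw [← pow_add]
    congr 1
    omega
  have h1 := (((hf.mul hg).add ((HasEvenJet.const m b₁).mul (aux hL₁ hg))).add
    ((HasEvenJet.const m b₂).mul (aux hL₂ hf)))
  have h2 : HasEvenJet m (fun r => L₁ r * L₂ r) 0 := by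
    refine HasEvenJet.of_isLittleO ((hL₁.mul hL₂).trans_isBigO ?_)
    simp only [← pow_add]
    exact isBigO_pow_pow_nhdsGT (by omega)
  have h3 := h1.add ((HasEvenJet.const m (b₁ * b₂)).mul h2)
  simp only [mul_zero, add_zero] at h3
  refine h3.congr' (Eventually.of_forall fun r => ?_)
  ring

/-- `r^{2m} log r`. -/
noncomputable def powLog (m : ℕ) (r : ℝ) : ℝ := r ^ (2 * m) * Real.log r

/-- `r d/dr` applied to `r^{2m} log r`. -/
noncomputable def eulerPowLog (m : ℕ) (r : ℝ) : ℝ := 2 * m * powLog m r + r ^ (2 * m)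

theorem isLittleO_powLog {m : ℕ} (hm : 1 ≤ m) :
    powLog m =o[𝓝[>] 0] fun r : ℝ => r ^ (2 * m - 1) := by
  have h1 : (fun r : ℝ => Real.log r * r) =o[𝓝[>] 0] fun _ => (1 : ℝ) := by
    rw [isLittleO_one_iff]
    simpa using tendsto_log_mul_rpow_nhdsGT_zero (r := 1) one_pos
  refine ((isBigO_refl (fun r : ℝ => r ^ (2 * m - 1)) (𝓝[>] 0)).mul_isLittleO h1).congr
    (fun r => ?_) fun r => mul_one _
  rw [powLog, show 2 * m = 2 * m - 1 + 1 by omega, pow_succ, Nat.add_sub_cancel]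
  ring

theorem isLittleO_eulerPowLog {m : ℕ} (hm : 1 ≤ m) :
    eulerPowLog m =o[𝓝[>] 0] fun r : ℝ => r ^ (2 * m - 1) :=
  ((isLittleO_powLog hm).const_mul_left _).add
    ((isLittleO_pow_pow (by omega)).mono nhdsWithin_le_nhds)

/-- `φ(r) = P(r²) + b r^{2m} log r + o(r^{2m})` as `r → 0+`, the expansion being differentiable term
by term; the dual number `z` is `P(0) + b ε`. -/
structure HasLogJet (m : ℕ) (φ : ℝ → ℝ) (P : ℝ[X]) (z : ℝ[ε]) : Prop where
  diff : ∀ᶠ r in 𝓝[>] 0, DifferentiableAt ℝ φ r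
  val : HasEvenJet m (fun r => φ r - z.snd * powLog m r) P
  der : HasEvenJet m (fun r => r * deriv φ r - z.snd * eulerPowLog m r) (2 * X * derivative P)
  fst : z.fst = P.coeff 0

namespace HasLogJet

variable {m : ℕ} {φ ψ : ℝ → ℝ} {P Q : ℝ[X]} {z w : ℝ[ε]}

theorem const (m : ℕ) (a : ℝ) : HasLogJet m (fun _ => a) (C a) (algebraMap ℝ ℝ[ε] a) where
  diff := by simp
  val := by simpa [snd_algebraMap_dualNumber] using HasEvenJet.const m a
  der := by simpa [snd_algebraMap_dualNumber] using HasEvenJet.const m (0 : ℝ)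
  fst := by simp [fst_algebraMap_dualNumber]

theorem add (hφ : HasLogJet m φ P z) (hψ : HasLogJet m ψ Q w) :
    HasLogJet m (fun r => φ r + ψ r) (P + Q) (z + w) where
  diff := by filter_upwards [hφ.diff, hψ.diff] with r h1 h2 using h1.add h2
  val := (hφ.val.add hψ.val).congr' (Eventually.of_forall fun r => by
    rw [TrivSqZeroExt.snd_add]; ring)
  der := by
    rw [derivative_add, mul_add]
    refine (hφ.der.add hψ.der).congr' ?_
    filter_upwards [hφ.diff, hψ.diff] with r h1 h2
    rw [deriv_fun_add h1 h2, TrivSqZeroExt.snd_add]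
    ring
  fst := by rw [TrivSqZeroExt.fst_add, coeff_add, hφ.fst, hψ.fst]

theorem mul (hm : 1 ≤ m) (hφ : HasLogJet m φ P z) (hψ : HasLogJet m ψ Q w) :
    HasLogJet m (fun r => φ r * ψ r) (P * Q) (z * w) where
  diff := by filter_upwards [hφ.diff, hψ.diff] with r h1 h2 using h1.mul h2
  val := by
    refine (HasEvenJet.mul_log hm (isLittleO_powLog hm) (isLittleO_powLog hm) hφ.val hψ.val).congr'
      (Eventually.of_forall fun r => ?_)
    rw [DualNumber.snd_mul, hφ.fst, hψ.fst]
    ring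
  der := by
    have h1 := HasEvenJet.mul_log hm (isLittleO_eulerPowLog hm) (isLittleO_powLog hm) hφ.der hψ.val
    have h2 := HasEvenJet.mul_log hm (isLittleO_powLog hm) (isLittleO_eulerPowLog hm) hφ.val hψ.der
    -- An Euler derivative has no constant term, so of the four logarithmic contributions only the
    -- two with `eulerPowLog` survive.
    have h3 : ∀ R : ℝ[X], (2 * X * derivative R).coeff 0 = 0 := fun R => by
      simp [mul_coeff_zero]
    rw [h3] at h1 h2
    have h4 := h1.add h2
    rw [derivative_mul, show 2 * X * (derivative P * Q + P * derivative Q)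
      = 2 * X * derivative P * Q + P * (2 * X * derivative Q) by ring]
    refine h4.congr' ?_
    filter_upwards [hφ.diff, hψ.diff] with r h1 h2
    rw [deriv_fun_mul h1 h2, DualNumber.snd_mul, hφ.fst, hψ.fst]
    ring
  fst := by rw [TrivSqZeroExt.fst_mul, mul_coeff_zero, hφ.fst, hψ.fst]

theorem sum {ι : Type*} (s : Finset ι) {φ : ι → ℝ → ℝ} {P : ι → ℝ[X]} {z : ι → ℝ[ε]}
    (h : ∀ i ∈ s, HasLogJet m (φ i) (P i) (z i)) :
    HasLogJet m (fun r => ∑ i ∈ s, φ i r) (∑ i ∈ s, P i) (∑ i ∈ s, z i) := by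
  classical
  induction s using Finset.induction_on with
  | empty => simpa using const m 0
  | insert a s ha ih =>
    simp only [Finset.sum_insert ha]
    exact (h a (Finset.mem_insert_self a s)).add
      (ih fun i hi => h i (Finset.mem_insert_of_mem hi))

theorem prod (hm : 1 ≤ m) {ι : Type*} (s : Finset ι) {φ : ι → ℝ → ℝ} {P : ι → ℝ[X]}
    {z : ι → ℝ[ε]} (h : ∀ i ∈ s, HasLogJet m (φ i) (P i) (z i)) :
    HasLogJet m (fun r => ∏ i ∈ s, φ i r) (∏ i ∈ s, P i) (∏ i ∈ s, z i) := by
  classical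
  induction s using Finset.induction_on with
  | empty => simpa using const m 1
  | insert a s ha ih =>
    simp only [Finset.prod_insert ha]
    exact (h a (Finset.mem_insert_self a s)).mul hm
      (ih fun i hi => h i (Finset.mem_insert_of_mem hi))

theorem det (hm : 1 ≤ m) {ι : Type*} [Fintype ι] [DecidableEq ι] {H : ℝ → Matrix ι ι ℝ}
    {P : Matrix ι ι ℝ[X]} {z : Matrix ι ι ℝ[ε]}
    (h : ∀ i j, HasLogJet m (fun r => H r i j) (P i j) (z i j)) :
    HasLogJet m (fun r => (H r).det) P.det z.det := by
  simp only [Matrix.det_apply']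
  refine sum _ fun σ _ => ?_
  have h1 := (const m ((Equiv.Perm.sign σ : ℤ) : ℝ)).mul hm
    (prod hm Finset.univ fun i _ => h (σ i) i)
  simpa using h1

end HasLogJet

/-- Write `A + ε L = A (1 + ε A⁻¹ L)`; the determinant of the second factor is `1 + ε tr(A⁻¹ L)`
because `ε² = 0`. Thus the trace condition removes the logarithm from the determinant. -/
theorem det_dualNumber {ι : Type*} [Fintype ι] [DecidableEq ι] {A L : Matrix ι ι ℝ}
    (hA : IsUnit A.det) (hL : (A⁻¹ * L).trace = 0) {z : Matrix ι ι ℝ[ε]}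
    (hfst : ∀ i j, (z i j).fst = A i j) (hsnd : ∀ i j, (z i j).snd = L i j) :
    z.det = algebraMap ℝ ℝ[ε] A.det := by
  have hz : z = A.map (algebraMap ℝ ℝ[ε])
      * (1 + (ε : ℝ[ε]) • (A⁻¹ * L).map (algebraMap ℝ ℝ[ε])) := by
    rw [mul_add, mul_one, Matrix.mul_smul, ← Matrix.map_mul, Matrix.mul_nonsing_inv_cancel_left _ _ hA]
    ext i j
    · simp [hfst, fst_algebraMap_dualNumber]
    · simp [hsnd, fst_algebraMap_dualNumber, snd_algebraMap_dualNumber]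
  have htr : ((A⁻¹ * L).map (algebraMap ℝ ℝ[ε])).trace = 0 := by
    have := AddMonoidHom.map_trace (algebraMap ℝ ℝ[ε]).toAddMonoidHom (A⁻¹ * L)
    rw [hL, map_zero] at this
    exact this.symm
  rw [hz, Matrix.det_mul, Matrix.det_one_add_smul, htr, eps_pow_two]
  have := RingHom.map_det (algebraMap ℝ ℝ[ε]) A
  simp [this]

end LogJets

/-! ### Even expansions together with first derivatives along the slice. -/

section SpatialJets

open Polynomial

variable {V : Type*} [NormedAddCommGroup V] [NormedSpace ℝ V]

/-- The restrictions to `{y} × (0, ε)` of `φ` and of its derivatives along `V` have expansions in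
even powers of `r`, up to `o(r^{2k})`. -/
structure HasSpatialJet (k : ℕ) (y : V) (φ : V × ℝ → ℝ) : Prop where
  diff : ∀ᶠ r in 𝓝[>] 0, DifferentiableAt ℝ φ (y, r)
  val : ∃ P, HasEvenJet k (fun r => φ (y, r)) P
  der : ∀ v : V, ∃ P, HasEvenJet k (fun r => fderiv ℝ φ (y, r) (v, 0)) P

namespace HasSpatialJet

variable {k : ℕ} {y : V} {φ ψ : V × ℝ → ℝ}

theorem const (k : ℕ) (y : V) (a : ℝ) : HasSpatialJet k y fun _ => a where
  diff := by simp
  val := ⟨_, .const k a⟩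
  der := fun v => ⟨C 0, by simpa using HasEvenJet.const k (0 : ℝ)⟩

theorem add (hφ : HasSpatialJet k y φ) (hψ : HasSpatialJet k y ψ) :
    HasSpatialJet k y fun p => φ p + ψ p where
  diff := by filter_upwards [hφ.diff, hψ.diff] with r h1 h2 using h1.add h2
  val := by
    obtain ⟨P, hP⟩ := hφ.val
    obtain ⟨Q, hQ⟩ := hψ.val
    exact ⟨_, hP.add hQ⟩
  der := fun v => by
    obtain ⟨P, hP⟩ := hφ.der v
    obtain ⟨Q, hQ⟩ := hψ.der v
    refine ⟨_, (hP.add hQ).congr' ?_⟩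
    filter_upwards [hφ.diff, hψ.diff] with r h1 h2
    rw [fderiv_fun_add h1 h2]
    rfl

theorem mul (hφ : HasSpatialJet k y φ) (hψ : HasSpatialJet k y ψ) :
    HasSpatialJet k y fun p => φ p * ψ p where
  diff := by filter_upwards [hφ.diff, hψ.diff] with r h1 h2 using h1.mul h2
  val := by
    obtain ⟨P, hP⟩ := hφ.val
    obtain ⟨Q, hQ⟩ := hψ.val
    exact ⟨_, hP.mul hQ⟩
  der := fun v => by
    obtain ⟨P, hP⟩ := hφ.der v
    obtain ⟨Q, hQ⟩ := hψ.der v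
    obtain ⟨P', hP'⟩ := hφ.val
    obtain ⟨Q', hQ'⟩ := hψ.val
    refine ⟨_, ((hP'.mul hQ).add (hQ'.mul hP)).congr' ?_⟩
    filter_upwards [hφ.diff, hψ.diff] with r h1 h2
    rw [fderiv_fun_mul h1 h2]
    rfl

theorem sum {ι : Type*} (s : Finset ι) {φ : ι → V × ℝ → ℝ}
    (h : ∀ i ∈ s, HasSpatialJet k y (φ i)) : HasSpatialJet k y fun p => ∑ i ∈ s, φ i p := by
  classical
  induction s using Finset.induction_on with
  | empty => simpa using const k y 0
  | insert a s ha ih =>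
    simp only [Finset.sum_insert ha]
    exact (h a (Finset.mem_insert_self a s)).add
      (ih fun i hi => h i (Finset.mem_insert_of_mem hi))

theorem prod {ι : Type*} (s : Finset ι) {φ : ι → V × ℝ → ℝ}
    (h : ∀ i ∈ s, HasSpatialJet k y (φ i)) : HasSpatialJet k y fun p => ∏ i ∈ s, φ i p := by
  classical
  induction s using Finset.induction_on with
  | empty => simpa using const k y 1
  | insert a s ha ih =>
    simp only [Finset.prod_insert ha]
    exact (h a (Finset.mem_insert_self a s)).mul
      (ih fun i hi => h i (Finset.mem_insert_of_mem hi))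

theorem inv (hφ : HasSpatialJet k y φ) {a : ℝ} (ha : a ≠ 0)
    (hlim : Tendsto (fun r => φ (y, r)) (𝓝[>] 0) (𝓝 a)) :
    HasSpatialJet k y fun p => (φ p)⁻¹ := by
  obtain ⟨P, hP⟩ := hφ.val
  obtain ⟨Q, hQ⟩ := hP.exists_inv (tendsto_nhds_unique hlim hP.tendsto ▸ ha)
  refine ⟨?_, ⟨Q, hQ⟩, fun v => ?_⟩
  · filter_upwards [hφ.diff, hlim.eventually_ne ha] with r h1 h2 using h1.inv h2
  · obtain ⟨P', hP'⟩ := hφ.der v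
    refine ⟨_, ((hQ.pow 2).mul hP').neg.congr' ?_⟩
    filter_upwards [hφ.diff, hlim.eventually_ne ha] with r h1 h2
    have h3 := (hasDerivAt_inv h2).comp_hasFDerivAt (y, r) h1.hasFDerivAt
    have h4 : fderiv ℝ (fun p => (φ p)⁻¹) (y, r) = _ := h3.fderiv
    rw [h4]
    simp

variable {ι : Type*} [Fintype ι] [DecidableEq ι]

theorem det {H : V × ℝ → Matrix ι ι ℝ} (h : ∀ i j, HasSpatialJet k y fun p => H p i j) :
    HasSpatialJet k y fun p => (H p).det := by
  simp only [Matrix.det_apply']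
  exact sum _ fun σ _ => (const k y _).mul (prod _ fun i _ => h _ _)

theorem matrix_inv {H : V × ℝ → Matrix ι ι ℝ} (h : ∀ i j, HasSpatialJet k y fun p => H p i j)
    {a : ℝ} (ha : a ≠ 0) (hlim : Tendsto (fun r => (H (y, r)).det) (𝓝[>] 0) (𝓝 a)) (i j : ι) :
    HasSpatialJet k y fun p => (H p)⁻¹ i j := by
  have h1 : HasSpatialJet k y fun p => (H p).adjugate i j := by
    simp only [Matrix.adjugate_apply]
    refine det fun i' j' => ?_
    by_cases hij : i' = j
    · subst hij
      simpa only [Matrix.updateRow_self] using const k y _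
    · simpa only [Matrix.updateRow_ne hij] using h i' j'
  have h2 := ((det h).inv ha hlim).mul h1
  simpa only [Matrix.inv_def, Ring.inverse_eq_inv', Matrix.smul_apply, smul_eq_mul] using h2

end HasSpatialJet

end SpatialJets

/-! ### Determinant and inverse of `r⁻² (dr² + H)`. -/

section ConformalProduct

variable {V ι : Type*} [Fintype ι] [DecidableEq ι]

/-- The components of `r⁻² (dr² + H)`. -/
noncomputable def conformalProduct (H : V × ℝ → Matrix ι ι ℝ) (p : V × ℝ) :
    Matrix (ι ⊕ Unit) (ι ⊕ Unit) ℝ :=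
  (p.2 ^ 2)⁻¹ • Matrix.fromBlocks (H p) 0 0 1

theorem sqrt_det_conformalProduct (H : V × ℝ → Matrix ι ι ℝ) {p : V × ℝ} (hp : 0 < p.2) :
    √(conformalProduct H p).det = (p.2 ^ (Fintype.card ι + 1))⁻¹ * √(H p).det := by
  rw [conformalProduct, Matrix.det_smul, Matrix.det_fromBlocks_zero₂₁, Matrix.det_one, mul_one,
    Fintype.card_sum, Fintype.card_unit, Real.sqrt_mul (by positivity), inv_pow, ← pow_mul,
    mul_comm 2, pow_mul, ← inv_pow, Real.sqrt_sq (by positivity)]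

theorem inv_conformalProduct (H : V × ℝ → Matrix ι ι ℝ) {p : V × ℝ} (hp : 0 < p.2)
    (hH : (H p).det ≠ 0) :
    (conformalProduct H p)⁻¹ = p.2 ^ 2 • Matrix.fromBlocks (H p)⁻¹ 0 0 1 := by
  refine Matrix.inv_eq_right_inv ?_
  have h1 : p.2 ^ 2 ≠ 0 := by positivity
  rw [conformalProduct, Matrix.smul_mul, Matrix.mul_smul, smul_smul, inv_mul_cancel₀ h1, one_smul,
    Matrix.fromBlocks_multiply]
  simp [Matrix.mul_nonsing_inv _ (isUnit_iff_ne_zero.2 hH), Matrix.fromBlocks_one]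

end ConformalProduct

/-! ### The Laplace-Beltrami operator of `r⁻² (dr² + H)`. -/

section Laplacian

variable {V : Type*} [NormedAddCommGroup V] [NormedSpace ℝ V]
variable {ι : Type*} [Fintype ι] [DecidableEq ι]

theorem laplaceBeltrami_eq_sum (b : ι → V) (G : V → Matrix ι ι ℝ) (u : V → ℂ) (p : V)
    (hG : ∀ i j, DifferentiableAt ℝ (fun q => √(G q).det * (G q)⁻¹ i j) p)
    (hu : ∀ j, DifferentiableAt ℝ (partialDeriv b j u) p) :
    laplaceBeltrami b G u p = ∑ i, ∑ j,
      (((√(G p).det)⁻¹ * partialDeriv b i (fun q => √(G q).det * (G q)⁻¹ i j) p)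
          • partialDeriv b j u p
        + ((√(G p).det)⁻¹ * (√(G p).det * (G p)⁻¹ i j))
          • partialDeriv b i (partialDeriv b j u) p) := by
  rw [laplaceBeltrami, Finset.smul_sum]
  refine Finset.sum_congr rfl fun i _ => ?_
  have h1 : ∀ j ∈ Finset.univ, DifferentiableAt ℝ
      (fun q => (√(G q).det * (G q)⁻¹ i j) • partialDeriv b j u q) p :=
    fun j _ => (hG i j).smul (hu j)
  rw [partialDeriv, fderiv_fun_sum h1, sum_apply, Finset.smul_sum]
  refine Finset.sum_congr rfl fun j _ => ?_
  rw [fderiv_fun_smul (hG i j) (hu j)]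
  simp only [add_apply, smul_apply,
    ContinuousLinearMap.smulRight_apply, smul_add, smul_smul, partialDeriv]
  rw [add_comm]

/-- The frame on `V × ℝ` made from a frame on `V` and `∂_r`. -/
def collarFrame (b : ι → V) : ι ⊕ Unit → V × ℝ :=
  Sum.elim (fun i => (b i, 0)) fun _ => (0, 1)

/-- The factor `r^{1-d}` of the density of the conformal product. -/
noncomputable def collarWeight (d : ℕ) (t : ℝ) : ℝ := t ^ 2 * (t ^ (d + 1))⁻¹

theorem hasDerivAt_collarWeight (d : ℕ) {r : ℝ} (hr : 0 < r) :
    HasDerivAt (collarWeight d) ((1 - d) * (collarWeight d r / r)) r := by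
  have h1 := ((hasDerivAt_id r).pow 2).mul (((hasDerivAt_id r).pow (d + 1)).inv (by simp [hr.ne']))
  refine h1.congr_deriv ?_
  simp only [collarWeight, id, Pi.pow_apply, Nat.add_sub_cancel, Pi.inv_apply]
  push_cast
  field_simp
  ring

variable {H : V × ℝ → Matrix ι ι ℝ} {y : V} {r : ℝ}

theorem differentiableAt_det {W : Type*} [NormedAddCommGroup W] [NormedSpace ℝ W]
    {A : W → Matrix ι ι ℝ} {p : W} (hA : ∀ i j, DifferentiableAt ℝ (fun q => A q i j) p) :
    DifferentiableAt ℝ (fun q => (A q).det) p := by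
  simp only [Matrix.det_apply']
  fun_prop

theorem differentiableAt_matrix_inv {W : Type*} [NormedAddCommGroup W] [NormedSpace ℝ W]
    {A : W → Matrix ι ι ℝ} {p : W} (hA : ∀ i j, DifferentiableAt ℝ (fun q => A q i j) p)
    (hdet : (A p).det ≠ 0) (i j : ι) : DifferentiableAt ℝ (fun q => (A q)⁻¹ i j) p := by
  have h1 : DifferentiableAt ℝ (fun q => (A q).adjugate i j) p := by
    simp only [Matrix.adjugate_apply]
    refine differentiableAt_det fun i' j' => ?_
    by_cases hij : i' = j
    · subst hij
      simp only [Matrix.updateRow_self]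
      exact differentiableAt_const _
    · simpa only [Matrix.updateRow_ne hij] using hA i' j'
  simp only [Matrix.inv_def, Ring.inverse_eq_inv', Matrix.smul_apply, smul_eq_mul]
  exact ((differentiableAt_det hA).inv hdet).mul h1

/-- The density contributes `r^{-(d+1)}` and the inverse metric `r²`. The block form rules out mixed
terms in the Laplacian; the equality holds on a neighbourhood, so it can be differentiated. -/
theorem density_conformalProduct_eventuallyEq (hr : 0 < r)
    (hH : ∀ i j, DifferentiableAt ℝ (fun q => H q i j) (y, r)) (hD : 0 < (H (y, r)).det) :
    (fun q => √(conformalProduct H q).det • (conformalProduct H q)⁻¹) =ᶠ[𝓝 (y, r)]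
      fun q => (collarWeight (Fintype.card ι) q.2 * √(H q).det) •
        Matrix.fromBlocks (H q)⁻¹ 0 0 (1 : Matrix Unit Unit ℝ) := by
  have h1 : ∀ᶠ q : V × ℝ in 𝓝 (y, r), 0 < q.2 :=
    continuous_snd.continuousAt.eventually_const_lt hr
  have h2 : ∀ᶠ q in 𝓝 (y, r), 0 < (H q).det :=
    (differentiableAt_det hH).continuousAt.eventually_const_lt hD
  filter_upwards [h1, h2] with q hq1 hq2
  rw [sqrt_det_conformalProduct H hq1, inv_conformalProduct H hq1 hq2.ne', smul_smul, collarWeight]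
  congr 1
  ring

/-- The Laplace-Beltrami operator of `r⁻² (dr² + H)`. -/
theorem laplaceBeltrami_conformalProduct (b : ι → V) (u : V × ℝ → ℂ) (hr : 0 < r)
    (hH : ∀ i j, DifferentiableAt ℝ (fun q => H q i j) (y, r)) (hD : 0 < (H (y, r)).det)
    (hu : ∀ j, DifferentiableAt ℝ (partialDeriv (collarFrame b) j u) (y, r)) :
    laplaceBeltrami (collarFrame b) (conformalProduct H) u (y, r)
      = (∑ i, ∑ j, r ^ 2 • (
          (fderiv ℝ (fun q => (H q)⁻¹ i j) (y, r) (b i, 0) + (H (y, r))⁻¹ i j *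
            (fderiv ℝ (fun q => (H q).det) (y, r) (b i, 0) * (2 * (H (y, r)).det)⁻¹))
            • partialDeriv (collarFrame b) (Sum.inl j) u (y, r)
          + (H (y, r))⁻¹ i j • partialDeriv (collarFrame b) (Sum.inl i)
            (partialDeriv (collarFrame b) (Sum.inl j) u) (y, r)))
        + (((1 - (Fintype.card ι : ℝ)) * r + r ^ 2 *
              (fderiv ℝ (fun q => (H q).det) (y, r) (0, 1) * (2 * (H (y, r)).det)⁻¹))
            • partialDeriv (collarFrame b) (Sum.inr ()) u (y, r)
          + r ^ 2 • partialDeriv (collarFrame b) (Sum.inr ())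
            (partialDeriv (collarFrame b) (Sum.inr ()) u) (y, r)) := by
  set d := Fintype.card ι with hd
  have hdens := density_conformalProduct_eventuallyEq hr hH hD
  have hentry : ∀ a c, (fun q => √(conformalProduct H q).det * (conformalProduct H q)⁻¹ a c)
      =ᶠ[𝓝 (y, r)] fun q => (collarWeight d q.2 * √(H q).det) *
        Matrix.fromBlocks (H q)⁻¹ 0 0 (1 : Matrix Unit Unit ℝ) a c := fun a c =>
    hdens.mono fun q hq => by simpa using congrFun (congrFun hq a) c
  have hρ : HasFDerivAt (fun q : V × ℝ => collarWeight d q.2 * √(H q).det)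
      (collarWeight d r • ((2 * √(H (y, r)).det)⁻¹ • fderiv ℝ (fun q => (H q).det) (y, r))
        + √(H (y, r)).det • (((1 - d) * (collarWeight d r / r)) • ContinuousLinearMap.snd ℝ V ℝ))
      (y, r) := by
    have h1 : HasFDerivAt (fun q : V × ℝ => collarWeight d q.2)
        (((1 - d) * (collarWeight d r / r)) • ContinuousLinearMap.snd ℝ V ℝ) (y, r) :=
      HasDerivAt.comp_hasFDerivAt (f := Prod.snd) (y, r) (hasDerivAt_collarWeight d hr)
        hasFDerivAt_snd
    have h2 := (differentiableAt_det hH).hasFDerivAt.sqrt hD.ne'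
    exact (h1.mul h2).congr_fderiv (by simp)
  have hW : ∀ i j, DifferentiableAt ℝ (fun q => (H q)⁻¹ i j) (y, r) :=
    differentiableAt_matrix_inv hH hD.ne'
  have hsqrt : (√(H (y, r)).det) ≠ 0 := (Real.sqrt_pos.2 hD).ne'
  have hsq : √(H (y, r)).det ^ 2 = (H (y, r)).det := Real.sq_sqrt hD.le
  have hll : ∀ i j, HasFDerivAt (fun q => √(conformalProduct H q).det *
      (conformalProduct H q)⁻¹ (Sum.inl i) (Sum.inl j)) _ (y, r) := fun i j =>
    (hρ.mul (hW i j).hasFDerivAt).congr_of_eventuallyEq (hentry (Sum.inl i) (Sum.inl j))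
  have hrr : HasFDerivAt (fun q => √(conformalProduct H q).det *
      (conformalProduct H q)⁻¹ (Sum.inr ()) (Sum.inr ())) _ (y, r) :=
    hρ.congr_of_eventuallyEq ((hentry (Sum.inr ()) (Sum.inr ())).trans (by simp))
  have hlr : ∀ i, HasFDerivAt (fun q => √(conformalProduct H q).det *
      (conformalProduct H q)⁻¹ (Sum.inl i) (Sum.inr ())) (0 : V × ℝ →L[ℝ] ℝ) (y, r) := fun i =>
    (hasFDerivAt_const (0 : ℝ) _).congr_of_eventuallyEq
      ((hentry (Sum.inl i) (Sum.inr ())).trans (by simp))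
  have hrl : ∀ i, HasFDerivAt (fun q => √(conformalProduct H q).det *
      (conformalProduct H q)⁻¹ (Sum.inr ()) (Sum.inl i)) (0 : V × ℝ →L[ℝ] ℝ) (y, r) := fun i =>
    (hasFDerivAt_const (0 : ℝ) _).congr_of_eventuallyEq
      ((hentry (Sum.inr ()) (Sum.inl i)).trans (by simp))
  have hG : ∀ a c, DifferentiableAt ℝ (fun q => √(conformalProduct H q).det *
      (conformalProduct H q)⁻¹ a c) (y, r) := by
    rintro (i | ⟨⟩) (j | ⟨⟩)
    exacts [(hll i j).differentiableAt, (hlr i).differentiableAt, (hrl j).differentiableAt,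
      hrr.differentiableAt]
  rw [laplaceBeltrami_eq_sum _ _ _ _ hG hu]
  simp only [Fintype.sum_sum_type, Finset.univ_unique, Finset.sum_singleton, PUnit.default_eq_unit]
  have hpd : ∀ a c, partialDeriv (collarFrame b) a (fun q => √(conformalProduct H q).det *
      (conformalProduct H q)⁻¹ a c) (y, r) = fderiv ℝ (fun q => √(conformalProduct H q).det *
      (conformalProduct H q)⁻¹ a c) (y, r) (collarFrame b a) := fun _ _ => rfl
  simp only [hpd, (hll _ _).fderiv, (hlr _).fderiv, (hrl _).fderiv, hrr.fderiv,
    (hentry _ _).self_of_nhds]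
  have hs1 : √(conformalProduct H (y, r)).det = (r ^ (d + 1))⁻¹ * √(H (y, r)).det :=
    sqrt_det_conformalProduct H hr
  have hcw : collarWeight d r = r ^ 2 * (r ^ (d + 1))⁻¹ := rfl
  have hr0 : r ≠ 0 := hr.ne'
  simp only [hs1, Matrix.fromBlocks_apply₁₁, Matrix.fromBlocks_apply₁₂, Matrix.fromBlocks_apply₂₁,
    Matrix.fromBlocks_apply₂₂, Matrix.zero_apply, Matrix.one_apply_eq, mul_zero, zero_smul,
    zero_apply, add_zero, Finset.sum_const_zero, zero_add, collarFrame,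
    Sum.elim_inl, Sum.elim_inr, add_apply, smul_apply,
    ContinuousLinearMap.coe_snd', smul_eq_mul, mul_one, hcw]
  -- Naming the square root and writing `det H = s²` makes the remaining identities rational in `s`
  -- and `r`.
  obtain ⟨s, hs⟩ : ∃ s, s = √(H (y, r)).det := ⟨_, rfl⟩
  simp only [← hs] at hsqrt hsq ⊢
  rw [← hsq]
  congr 1
  · refine Finset.sum_congr rfl fun i _ => Finset.sum_congr rfl fun j _ => ?_
    rw [smul_add, smul_smul, smul_smul]
    congr 2
    · field_simp
    · field_simp
  · congr 2
    · field_simp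
      ring
    · field_simp

end Laplacian

/-! ### Derivatives of finite sums `∑ r^{μ_j} α_j`. -/

section PowerSums

variable {V : Type*} [NormedAddCommGroup V] [NormedSpace ℝ V]

/-- `∑_{j ∈ s} r^{μ_j} α_j`. -/
noncomputable def powerSum (s : Finset ℕ) (μ : ℕ → ℂ) (α : ℕ → V → ℂ) (q : V × ℝ) : ℂ :=
  ∑ j ∈ s, (q.2 : ℂ) ^ μ j * α j q.1

theorem hasDerivAt_ofReal_cpow {r : ℝ} (hr : 0 < r) (μ : ℂ) :
    HasDerivAt (fun t : ℝ => (t : ℂ) ^ μ) (μ * (r : ℂ) ^ (μ - 1)) r := by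
  have h1 := (hasDerivAt_id (r : ℂ)).cpow_const (c := μ) (Or.inl (by simpa using hr))
  simpa using h1.comp_ofReal

theorem hasFDerivAt_powerSum (s : Finset ℕ) (μ : ℕ → ℂ) {α : ℕ → V → ℂ} {q : V × ℝ}
    (hq : 0 < q.2) (hα : ∀ j ∈ s, DifferentiableAt ℝ (α j) q.1) :
    DifferentiableAt ℝ (powerSum s μ α) q ∧
    (∀ v, fderiv ℝ (powerSum s μ α) q (v, 0) = powerSum s μ (fun j x => fderiv ℝ (α j) x v) q) ∧
    fderiv ℝ (powerSum s μ α) q (0, 1)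
      = powerSum s (fun j => μ j - 1) (fun j x => μ j * α j x) q := by
  have h1 : HasFDerivAt (powerSum s μ α) (∑ j ∈ s,
      (((q.2 : ℂ) ^ μ j) • (fderiv ℝ (α j) q.1).comp (ContinuousLinearMap.fst ℝ V ℝ)
        + (α j q.1) • (ContinuousLinearMap.snd ℝ V ℝ).smulRight (μ j * (q.2 : ℂ) ^ (μ j - 1)))) q := by
    refine HasFDerivAt.fun_sum fun j hj => ?_
    have h2 := (hα j hj).hasFDerivAt.comp q hasFDerivAt_fst
    have h3 : HasFDerivAt (fun p : V × ℝ => (p.2 : ℂ) ^ μ j) _ q :=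
      (hasDerivAt_ofReal_cpow hq (μ j)).hasFDerivAt.comp q hasFDerivAt_snd
    refine (h3.mul h2).congr_fderiv ?_
    ext <;> simp
  refine ⟨h1.differentiableAt, fun v => ?_, ?_⟩
  · rw [h1.fderiv, sum_apply]
    exact Finset.sum_congr rfl fun j _ => by simp
  · rw [h1.fderiv, sum_apply]
    exact Finset.sum_congr rfl fun j _ => by simp; ring

end PowerSums

/-! ### The Laplacian on sums of powers of `r`. -/

section LaplacianOfPowerSums

variable {V : Type*} [NormedAddCommGroup V] [NormedSpace ℝ V]
variable {ι : Type*} [Fintype ι] [DecidableEq ι]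

/-- The coefficient of `∂_j`, in the term with indices `i, j` of the Laplacian
`D^{-1/2} ∂_i (D^{1/2} H^{ij} ∂_j)`, where `D = det H`. -/
noncomputable def gradientCoeff (b : ι → V) (H : V × ℝ → Matrix ι ι ℝ) (i j : ι) (p : V × ℝ) : ℝ :=
  fderiv ℝ (fun q => (H q)⁻¹ i j) p (b i, 0) + (H p)⁻¹ i j *
    (fderiv ℝ (fun q => (H q).det) p (b i, 0) * (2 * (H p).det)⁻¹)

/-- The logarithmic derivative `r ∂_r log det H`. -/
noncomputable def eulerLogDet (H : V × ℝ → Matrix ι ι ℝ) (p : V × ℝ) : ℝ :=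
  p.2 * fderiv ℝ (fun q => (H q).det) p (0, 1) * ((H p).det)⁻¹

/-- The Laplacian of the slice `V × {r}` applied to `α`. -/
noncomputable def sliceLaplacian (b : ι → V) (H : V × ℝ → Matrix ι ι ℝ) (α : V → ℂ) (p : V × ℝ) :
    ℂ :=
  ∑ i, ∑ j, ((gradientCoeff b H i j p : ℂ) * fderiv ℝ α p.1 (b j)
    + ((H p)⁻¹ i j : ℂ) * fderiv ℝ (fun x => fderiv ℝ α x (b j)) p.1 (b i))

variable {H : V × ℝ → Matrix ι ι ℝ} {y : V} {r : ℝ}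

/-- Tangential derivatives act on `α_j` and radial ones on `r^{μ_j}`. The factor `r ∂_r log det H /
2` is the derivative of the density `√det H`; without it the radial part is the indicial polynomial
`μ (μ - d)`. -/
theorem laplaceBeltrami_powerSum (b : ι → V) (hr : 0 < r)
    (hH : ∀ i j, DifferentiableAt ℝ (fun q => H q i j) (y, r)) (hD : 0 < (H (y, r)).det)
    (s : Finset ℕ) (μ : ℕ → ℂ) {α : ℕ → V → ℂ} {Ω : Set V} (hΩ : IsOpen Ω) (hy : y ∈ Ω)
    (hα : ∀ j ∈ s, ContDiffOn ℝ ∞ (α j) Ω) :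
    laplaceBeltrami (collarFrame b) (conformalProduct H) (powerSum s μ α) (y, r)
      = ∑ j ∈ s, (r : ℂ) ^ μ j * ((r : ℂ) ^ 2 * sliceLaplacian b H (α j) (y, r)
        + (((1 - (Fintype.card ι : ℂ)) + (eulerLogDet H (y, r) : ℂ) / 2) * μ j
          + μ j * (μ j - 1)) * α j y) := by
  have hnear : ∀ᶠ q : V × ℝ in 𝓝 (y, r), q.1 ∈ Ω ∧ 0 < q.2 :=
    (continuous_fst.continuousAt.eventually_mem (hΩ.mem_nhds hy)).and
      (continuous_snd.continuousAt.eventually_const_lt hr)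
  have hα1 : ∀ j ∈ s, ∀ x ∈ Ω, DifferentiableAt ℝ (α j) x := fun j hj x hx =>
    ((hα j hj).differentiableOn (by simp)).differentiableAt (hΩ.mem_nhds hx)
  have hα2 : ∀ j ∈ s, ∀ v, DifferentiableAt ℝ (fun x => fderiv ℝ (α j) x v) y := fun j hj v => by
    have h1 : ContDiffOn ℝ 1 (fderiv ℝ (α j)) Ω := (hα j hj).fderiv_of_isOpen hΩ (by
      exact WithTop.coe_le_coe.2 le_top)
    exact ((h1.differentiableOn one_ne_zero).differentiableAt (hΩ.mem_nhds hy)).clm_apply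
      (differentiableAt_const v)
  have hl : ∀ i, partialDeriv (collarFrame b) (Sum.inl i) (powerSum s μ α) =ᶠ[𝓝 (y, r)]
      powerSum s μ (fun j x => fderiv ℝ (α j) x (b i)) := fun i => by
    filter_upwards [hnear] with q hq
    exact (hasFDerivAt_powerSum s μ hq.2 fun j hj => hα1 j hj _ hq.1).2.1 (b i)
  have hrr : partialDeriv (collarFrame b) (Sum.inr ()) (powerSum s μ α) =ᶠ[𝓝 (y, r)]
      powerSum s (fun j => μ j - 1) (fun j x => μ j * α j x) := by
    filter_upwards [hnear] with q hq
    exact (hasFDerivAt_powerSum s μ hq.2 fun j hj => hα1 j hj _ hq.1).2.2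
  have hL := fun i => hasFDerivAt_powerSum (q := (y, r)) s μ hr fun j hj => hα2 j hj (b i)
  have hR := hasFDerivAt_powerSum (q := (y, r)) s (fun j => μ j - 1)
    (α := fun j x => μ j * α j x) hr fun j hj => (hα1 j hj y hy).const_mul (μ j)
  have hdiff : ∀ a, DifferentiableAt ℝ (partialDeriv (collarFrame b) a (powerSum s μ α)) (y, r) := by
    rintro (i | ⟨⟩)
    · exact (hL i).1.congr_of_eventuallyEq (hl i)
    · exact hR.1.congr_of_eventuallyEq hrr
  have hll : ∀ i j, partialDeriv (collarFrame b) (Sum.inl i)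
      (partialDeriv (collarFrame b) (Sum.inl j) (powerSum s μ α)) (y, r)
        = powerSum s μ (fun k x => fderiv ℝ (fun x' => fderiv ℝ (α k) x' (b j)) x (b i)) (y, r) :=
    fun i j => by
      rw [partialDeriv, (hl j).fderiv_eq]
      exact (hL j).2.1 (b i)
  have hrr' : partialDeriv (collarFrame b) (Sum.inr ())
      (partialDeriv (collarFrame b) (Sum.inr ()) (powerSum s μ α)) (y, r)
        = powerSum s (fun j => μ j - 1 - 1) (fun j x => (μ j - 1) * (μ j * α j x)) (y, r) := by
    rw [partialDeriv, hrr.fderiv_eq]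
    exact hR.2.2
  rw [laplaceBeltrami_conformalProduct b _ hr hH hD hdiff]
  simp only [hll, hrr', (hl _).self_of_nhds, hrr.self_of_nhds]
  have hr0 : (r : ℂ) ≠ 0 := by exact_mod_cast hr.ne'
  have hdet : ((H (y, r)).det : ℂ) ≠ 0 := by exact_mod_cast hD.ne'
  -- The sum over `j` is split so that the tangential and radial parts can be matched separately.
  refine Eq.trans ?_
    ((Finset.sum_congr rfl fun k _ => mul_add _ _ _).trans Finset.sum_add_distrib).symm
  congr 1
  · simp only [sliceLaplacian, Finset.mul_sum]
    conv_rhs => rw [Finset.sum_comm]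
    refine Finset.sum_congr rfl fun i _ => ?_
    conv_rhs => rw [Finset.sum_comm]
    refine Finset.sum_congr rfl fun j _ => ?_
    simp only [powerSum, Complex.real_smul, Finset.mul_sum, ← Finset.sum_add_distrib]
    refine Finset.sum_congr rfl fun k _ => ?_
    simp only [gradientCoeff]
    push_cast
    ring
  · simp only [powerSum, Complex.real_smul, Finset.mul_sum, ← Finset.sum_add_distrib]
    refine Finset.sum_congr rfl fun k _ => ?_
    rw [Complex.cpow_sub (μ k - 1) 1 hr0, Complex.cpow_sub (μ k) 1 hr0, Complex.cpow_one, eulerLogDet]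
    push_cast
    field_simp

end LaplacianOfPowerSums

/-! ### The recursion at a point of a chart. -/

section LocalRecursion

open Polynomial

variable {V : Type*} [NormedAddCommGroup V] [NormedSpace ℝ V]
variable {ι : Type*} [Fintype ι] [DecidableEq ι]

/-- The family of matrices `H(·, r)` has an expansion
`A + r² (⋯) + ⋯ + r^{2m} (⋯ + log r · L) + o(r^{2m})` at `y`, with `det A > 0` and `tr(A⁻¹ L) = 0`,
which may be differentiated once. -/
structure HasMetricJet (m : ℕ) (y : V) (H : V × ℝ → Matrix ι ι ℝ) (A L : Matrix ι ι ℝ) :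
    Prop where
  spatial : ∀ i j, HasSpatialJet (m - 1) y fun p => H p i j
  log : ∀ i j, ∃ P z, HasLogJet m (fun r => H (y, r) i j) P z ∧ z.fst = A i j ∧ z.snd = L i j
  det_pos : 0 < A.det
  trace_eq_zero : (A⁻¹ * L).trace = 0

/-- The expansions at `y` of the coefficients of the Laplacian of `r⁻² (dr² + H)`. -/
structure LaplacianJet (m : ℕ) (y : V) (b : ι → V) (H : V × ℝ → Matrix ι ι ℝ)
    (A : Matrix ι ι ℝ) where
  /-- The expansion of `det H`. -/
  det : ℝ[X]
  /-- The expansion of `r ∂_r log det H`. -/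
  euler : ℝ[X]
  /-- The expansion of the first order coefficients. -/
  gradient : ι → ι → ℝ[X]
  /-- The expansion of the second order coefficients. -/
  symbol : ι → ι → ℝ[X]
  det_jet : HasEvenJet m (fun r => (H (y, r)).det) det
  det_coeff_zero : det.coeff 0 = A.det
  euler_jet : HasEvenJet m (fun r => eulerLogDet H (y, r)) euler
  euler_mul_det : X ^ (m + 1) ∣ euler * det - 2 * X * derivative det
  gradient_jet : ∀ i j, HasEvenJet (m - 1) (fun r => gradientCoeff b H i j (y, r)) (gradient i j)
  symbol_jet : ∀ i j, HasEvenJet (m - 1) (fun r => (H (y, r))⁻¹ i j) (symbol i j)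

variable {m : ℕ} {y : V} {H : V × ℝ → Matrix ι ι ℝ} {A L : Matrix ι ι ℝ}

theorem HasMetricJet.eventually_differentiableAt (h : HasMetricJet m y H A L) :
    ∀ᶠ r in 𝓝[>] 0, ∀ i j, DifferentiableAt ℝ (fun q => H q i j) (y, r) := by
  simp only [eventually_all]
  exact fun i j => (h.spatial i j).diff

theorem fderiv_apply_zero_one {φ : V × ℝ → ℝ} {r : ℝ} (h : DifferentiableAt ℝ φ (y, r)) :
    HasDerivAt (fun t => φ (y, t)) (fderiv ℝ φ (y, r) (0, 1)) r :=
  h.hasFDerivAt.comp_hasDerivAt (f := fun t => (y, t)) r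
    ((hasDerivAt_const r y).prodMk (hasDerivAt_id r))

/-- The dual number attached to `det H` is `det(A + ε L)`, which has no `ε`-part by the trace
condition. Hence neither the determinant nor its Euler derivative has a logarithmic term up to
`o(r^{2m})`. -/
theorem HasMetricJet.det_logJet (hm : 1 ≤ m) (h : HasMetricJet m y H A L) :
    ∃ D : ℝ[X], HasEvenJet m (fun r => (H (y, r)).det) D ∧ D.coeff 0 = A.det ∧
      HasEvenJet m (fun r => r * deriv (fun t => (H (y, t)).det) r) (2 * X * derivative D) := by
  choose P z hP hfst hsnd using h.log
  have hz := det_dualNumber (isUnit_iff_ne_zero.2 h.det_pos.ne') h.trace_eq_zero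
    (z := Matrix.of z) hfst hsnd
  have h1 := HasLogJet.det hm (H := fun r => H (y, r)) (P := Matrix.of P) (z := Matrix.of z) hP
  refine ⟨_, h1.val.congr' ?_, ?_, h1.der.congr' ?_⟩
  · simp [hz, snd_algebraMap_dualNumber]
  · rw [← h1.fst, hz, fst_algebraMap_dualNumber]
  · simp [hz, snd_algebraMap_dualNumber]

/-- The tangential coefficients are expanded only to order `m - 1`, where the logarithm is not yet
visible; they will be multiplied by `r²`. The logarithmic derivative is needed to order `m`, which
is where the trace condition enters. -/
theorem HasMetricJet.nonempty_laplacianJet (hm : 1 ≤ m) (h : HasMetricJet m y H A L)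
    (b : ι → V) : Nonempty (LaplacianJet m y b H A) := by
  obtain ⟨D, hD, hD0, hD'⟩ := h.det_logJet hm
  have hA := h.det_pos.ne'
  have hlim : Tendsto (fun r => (H (y, r)).det) (𝓝[>] 0) (𝓝 A.det) := hD0 ▸ hD.tendsto
  obtain ⟨E, hE⟩ := hD.exists_inv (hD0 ▸ hA)
  have heuler : HasEvenJet m (fun r => eulerLogDet H (y, r)) (2 * X * derivative D * E) := by
    refine (hD'.mul hE).congr' ?_
    filter_upwards [h.eventually_differentiableAt] with r hr
    rw [(fderiv_apply_zero_one (differentiableAt_det hr)).deriv, eulerLogDet]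
  have hdet := HasSpatialJet.det h.spatial
  have hinv := HasSpatialJet.matrix_inv h.spatial hA hlim
  choose W hW using fun i j => (hinv i j).val
  have hgrad : ∀ i j, ∃ R, HasEvenJet (m - 1) (fun r => gradientCoeff b H i j (y, r)) R := by
    intro i j
    obtain ⟨P, hP⟩ := (hinv i j).der (b i)
    obtain ⟨Q, hQ⟩ := hdet.der (b i)
    refine ⟨_, (hP.add ((hW i j).mul (hQ.mul
      ((HasEvenJet.const _ (2⁻¹ : ℝ)).mul (hE.mono (Nat.sub_le m 1)))))).congr'
        (Eventually.of_forall fun r => ?_)⟩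
    simp only [gradientCoeff, mul_inv]
  choose R hR using hgrad
  refine ⟨D, 2 * X * derivative D * E, R, W, hD, hD0, heuler, ?_, hR, hW⟩
  -- Two expansions of the same function `r ∂_r det H` give the required congruence.
  have h1 : HasEvenJet m (fun r => r * deriv (fun t => (H (y, t)).det) r)
      (2 * X * derivative D * E * D) := by
    refine ((hD'.mul hE).mul hD).congr' ?_
    filter_upwards [hlim.eventually_ne hA] with r hr
    field_simp
  exact h1.X_pow_dvd_sub hD'

namespace LaplacianJet

variable {b : ι → V}

theorem euler_coeff_zero (J : LaplacianJet m y b H A) (hA : A.det ≠ 0) : J.euler.coeff 0 = 0 := by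
  have h4 := X_pow_dvd_iff.1 J.euler_mul_det 0 (by omega)
  simpa [mul_coeff_zero, J.det_coeff_zero, hA] using h4

/-- The coefficient of `r^{2k}` in the expansion of the Laplacian of `H(·, r)`, applied to `α`
at `y`. -/
noncomputable def laplacianCoeff (J : LaplacianJet m y b H A) (k : ℕ) (α : V → ℂ) : ℂ :=
  ∑ i, ∑ j, (((J.gradient i j).coeff k : ℂ) * fderiv ℝ α y (b j)
    + ((J.symbol i j).coeff k : ℂ) * fderiv ℝ (fun x => fderiv ℝ α x (b j)) y (b i))

theorem exists_sliceLaplacian_jet (J : LaplacianJet m y b H A) (α : V → ℂ) :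
    ∃ P : ℂ[X], HasEvenJet (m - 1) (fun r => sliceLaplacian b H α (y, r)) P ∧
      ∀ k, P.coeff k = J.laplacianCoeff k α := by
  refine ⟨_, HasEvenJet.sum _ fun i _ => HasEvenJet.sum _ fun j _ =>
    ((J.gradient_jet i j).ofReal.mul (HasEvenJet.const _ (fderiv ℝ α y (b j)))).add
      ((J.symbol_jet i j).ofReal.mul
        (HasEvenJet.const _ (fderiv ℝ (fun x => fderiv ℝ α x (b j)) y (b i)))), fun k => ?_⟩
  simp only [finsetSum_coeff, coeff_add, coeff_mul_C, coeff_map, laplacianCoeff]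
  rfl

end LaplacianJet

theorem ofReal_cpow_add_two_mul {r : ℝ} (hr : 0 < r) (lam : ℂ) (j : ℕ) :
    (r : ℂ) ^ (lam + 2 * j) = (r : ℂ) ^ lam * (r : ℂ) ^ (2 * j) := by
  rw [Complex.cpow_add _ _ (by exact_mod_cast hr.ne')]
  congr 1
  exact_mod_cast Complex.cpow_natCast (r : ℂ) (2 * j)

/-- The recursion for the coefficients of a formal solution of `-Δ u = λ (n - λ) u`. -/
theorem coeff_recursion_of_formal_solution {b : ι → V} (J : LaplacianJet m y b H A) (hm : 1 ≤ m)
    (hcard : Fintype.card ι = 2 * m) (hjet : HasMetricJet m y H A L) {N : ℕ}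
    (hNm : N ≤ m) (lam : ℂ) {α : ℕ → V → ℂ} {Ω : Set V} (hΩ : IsOpen Ω) (hy : y ∈ Ω)
    (hα : ∀ j, ContDiffOn ℝ ∞ (α j) Ω)
    (hu : (fun r : ℝ => -laplaceBeltrami (collarFrame b) (conformalProduct H)
        (powerSum (Finset.range (N + 1)) (fun j => lam + 2 * j) α) (y, r)
        - lam * ((Fintype.card ι : ℂ) - lam)
          * powerSum (Finset.range (N + 1)) (fun j => lam + 2 * j) α (y, r))
      =o[𝓝[>] 0] fun r : ℝ => (r : ℂ) ^ (lam + 2 * N)) :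
    4 * (N : ℂ) * (lam - (m : ℂ) + N) * α N y
      = -∑ j ∈ Finset.range N, ((lam + 2 * j) / 2 * (J.euler.coeff (N - j) : ℂ) * α j y
          + J.laplacianCoeff (N - 1 - j) (α j)) := by
  have hA := hjet.det_pos.ne'
  choose B hB hBcoeff using fun j => J.exists_sliceLaplacian_jet (α j)
  -- The constant is `(λ + 2j)(λ + 2j - 2m) + λ (2m - λ) = 4j (λ + j - m)`.
  set S : ℕ → ℝ → ℂ := fun j r => 4 * j * (lam + j - m) * α j y
    + (lam + 2 * j) * α j y / 2 * (eulerLogDet H (y, r) : ℂ)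
    + (r : ℂ) ^ 2 * sliceLaplacian b H (α j) (y, r) with hS
  set Q : ℕ → ℂ[X] := fun j => C (4 * j * (lam + j - m) * α j y)
    + C ((lam + 2 * j) * α j y / 2) * J.euler.map Complex.ofRealHom + X * B j with hQ
  have hSQ : ∀ j, HasEvenJet m (S j) (Q j) := fun j => by
    have h1 := (hB j).sq_mul_succ
    rw [Nat.sub_add_cancel hm] at h1
    exact ((HasEvenJet.const m _).add ((HasEvenJet.const m _).mul J.euler_jet.ofReal)).add h1
  have hsum : HasEvenJet N (fun r : ℝ => ∑ j ∈ Finset.range (N + 1), (r : ℂ) ^ (2 * j) * S j r)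
      (∑ j ∈ Finset.range (N + 1), X ^ j * Q j) :=
    (HasEvenJet.sum _ fun j _ => (hSQ j).pow_mul j).mono hNm
  have hzero : HasEvenJet N (fun r : ℝ => ∑ j ∈ Finset.range (N + 1), (r : ℂ) ^ (2 * j) * S j r)
      0 := by
    refine HasEvenJet.of_isLittleO ?_
    -- Dividing by `r^λ`, which does not vanish for `r > 0`, leaves an expansion in even powers.
    have h1 := (isBigO_refl (fun r : ℝ => ((r : ℂ) ^ lam)⁻¹) (𝓝[>] 0)).mul_isLittleO hu.neg_left
    have h2 : (fun r : ℝ => ((r : ℂ) ^ lam)⁻¹ * (r : ℂ) ^ (lam + 2 * N)) =O[𝓝[>] 0]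
        fun r : ℝ => r ^ (2 * N) := by
      refine IsBigO.of_norm_eventuallyLE ?_
      filter_upwards [self_mem_nhdsWithin] with r hr
      have hr' : (r : ℂ) ^ lam ≠ 0 := by
        rw [Complex.cpow_ne_zero_iff]
        exact Or.inl (by exact_mod_cast (ne_of_gt hr))
      rw [ofReal_cpow_add_two_mul hr, inv_mul_cancel_left₀ hr', norm_pow, Complex.norm_real,
        Real.norm_of_nonneg (le_of_lt hr)]
    refine (h1.trans_isBigO h2).congr' ?_ EventuallyEq.rfl
    have hlim : Tendsto (fun r => (H (y, r)).det) (𝓝[>] 0) (𝓝 A.det) :=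
      J.det_coeff_zero ▸ J.det_jet.tendsto
    filter_upwards [self_mem_nhdsWithin, hjet.eventually_differentiableAt,
      hlim.eventually_const_lt hjet.det_pos] with r hr hdiff hdet
    have hr' : (r : ℂ) ^ lam ≠ 0 := by
      rw [Complex.cpow_ne_zero_iff]
      exact Or.inl (by exact_mod_cast (ne_of_gt hr))
    rw [laplaceBeltrami_powerSum b hr hdiff hdet _ _ hΩ hy fun j _ => hα j, inv_mul_eq_iff_eq_mul₀ hr']
    simp only [powerSum, neg_sub, sub_neg_eq_add, Finset.mul_sum, ← Finset.sum_add_distrib]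
    refine Finset.sum_congr rfl fun j _ => ?_
    rw [ofReal_cpow_add_two_mul hr, hcard, hS]
    push_cast
    ring
  have hcoeff := hsum.coeff_eq hzero le_rfl
  have hQ0 : (Q N).coeff 0 = 4 * (N : ℂ) * (lam - (m : ℂ) + N) * α N y := by
    have h0 : (J.euler.map Complex.ofRealHom).coeff 0 = 0 := by
      rw [coeff_map, J.euler_coeff_zero hA, map_zero]
    simp only [hQ, coeff_add, mul_coeff_zero, coeff_C_zero, coeff_X_zero, h0]
    ring
  have hQk : ∀ j, ∀ k, (Q j).coeff (k + 1)
      = (lam + 2 * j) / 2 * (J.euler.coeff (k + 1) : ℂ) * α j y + J.laplacianCoeff k (α j) := by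
    intro j k
    simp only [hQ, coeff_add, coeff_C_succ, coeff_C_mul, coeff_map, coeff_X_mul, hBcoeff,
      Complex.ofRealHom_eq_coe]
    ring
  -- In the coefficient of `X ^ N`, the term `j = N` enters through its constant coefficient, where
  -- `E` contributes nothing. A term `j < N` enters through coefficient `N - j`, which for the
  -- Laplacian becomes `N - 1 - j` because of the factor `r²`.
  rw [finsetSum_coeff, Finset.sum_range_succ, coeff_zero] at hcoeff
  have h1 : (X ^ N * Q N).coeff N = (Q N).coeff 0 := by
    simpa using coeff_X_pow_mul (Q N) N 0
  rw [h1, hQ0] at hcoeff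
  rw [eq_neg_iff_add_eq_zero, add_comm, ← hcoeff]
  congr 1
  refine Finset.sum_congr rfl fun j hj => ?_
  have hj := Finset.mem_range.1 hj
  rw [coeff_X_pow_mul', if_pos hj.le, show N - j = (N - 1 - j) + 1 by omega, hQk]

end LocalRecursion

/-! ### From expansions differentiable once to the jets used above. -/

section ExpansionJets

open Polynomial DualNumber

variable {V : Type*} [NormedAddCommGroup V] [NormedSpace ℝ V]

/-- The remainder of an expansion `∑_{k ≤ d/2} r^{2k} C_k + r^d log r · ℓ` of `φ`. -/
noncomputable def expansionRemainder (d : ℕ) (φ : V × ℝ → ℝ) (C : ℕ → V → ℝ) (ℓ : V → ℝ)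
    (q : V × ℝ) : ℝ :=
  φ q - ∑ k ∈ Finset.range (d / 2 + 1), q.2 ^ (2 * k) * C k q.1 - q.2 ^ d * Real.log q.2 * ℓ q.1

variable {m : ℕ} {φ : V × ℝ → ℝ} {a : ℕ → V → ℝ} {ℓ : V → ℝ} {y : V}

theorem hasDerivAt_powLog (m : ℕ) {r : ℝ} (hr : 0 < r) :
    HasDerivAt (powLog m) (r⁻¹ * eulerPowLog m r) r := by
  have h1 := ((hasDerivAt_id r).pow (2 * m)).mul (Real.hasDerivAt_log hr.ne')
  refine (h1.congr_of_eventuallyEq (Eventually.of_forall fun t => by simp [powLog])).congr_deriv ?_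
  simp only [id, eulerPowLog, powLog, Pi.pow_apply, mul_one]
  rcases Nat.eq_zero_or_pos m with rfl | hm
  · simp
  · have : r ^ (2 * m) = r ^ (2 * m - 1) * r := by rw [← pow_succ]; congr 1; omega
    rw [this]
    push_cast
    field_simp

theorem hasDerivAt_sq_pow (k : ℕ) {r : ℝ} (hr : 0 < r) :
    HasDerivAt (fun t : ℝ => t ^ (2 * k)) (r⁻¹ * (2 * k * r ^ (2 * k))) r := by
  refine (hasDerivAt_pow (2 * k) r).congr_deriv ?_
  rcases Nat.eq_zero_or_pos k with rfl | hk
  · simp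
  · have : r ^ (2 * k) = r ^ (2 * k - 1) * r := by rw [← pow_succ]; congr 1; omega
    rw [this]
    push_cast
    field_simp

theorem hasFDerivAt_expansionRemainder {r : ℝ} (hr : 0 < r) (hφ : DifferentiableAt ℝ φ (y, r))
    (ha : ∀ k ≤ m, DifferentiableAt ℝ (a k) y) (hℓ : DifferentiableAt ℝ ℓ y) (v : V) (t : ℝ) :
    fderiv ℝ φ (y, r) (v, t) = fderiv ℝ (expansionRemainder (2 * m) φ a ℓ) (y, r) (v, t)
      + (∑ k ∈ Finset.range (m + 1), r ^ (2 * k) * fderiv ℝ (a k) y v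
        + powLog m r * fderiv ℝ ℓ y v)
      + t * r⁻¹ * (∑ k ∈ Finset.range (m + 1), 2 * k * r ^ (2 * k) * a k y
        + eulerPowLog m r * ℓ y) := by
  have hterm : ∀ {ψ : ℝ → ℝ} {ψ' : ℝ} {β : V → ℝ}, HasDerivAt ψ ψ' r → DifferentiableAt ℝ β y →
      HasFDerivAt (fun q : V × ℝ => ψ q.2 * β q.1)
        (ψ r • (fderiv ℝ β y).comp (ContinuousLinearMap.fst ℝ V ℝ)
          + β y • ψ' • ContinuousLinearMap.snd ℝ V ℝ) (y, r) := by
    intro ψ ψ' β hψ hβ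
    have h1 := HasDerivAt.comp_hasFDerivAt (f := Prod.snd) (y, r) hψ
      (hasFDerivAt_snd (𝕜 := ℝ) (E := V))
    have h2 := HasFDerivAt.comp (f := Prod.fst) (y, r) hβ.hasFDerivAt
      (hasFDerivAt_fst (𝕜 := ℝ) (F := ℝ))
    exact h1.mul h2
  have h1 := (hφ.hasFDerivAt.sub (HasFDerivAt.fun_sum (u := Finset.range (m + 1)) fun k hk =>
    hterm (hasDerivAt_sq_pow k hr) (ha k (by simpa [Nat.lt_succ_iff] using hk)))).sub
      (hterm (hasDerivAt_powLog m hr) hℓ)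
  have h2 : HasFDerivAt (expansionRemainder (2 * m) φ a ℓ) _ (y, r) :=
    h1.congr_of_eventuallyEq (Eventually.of_forall fun q => by
      simp [expansionRemainder, powLog])
  rw [h2.fderiv]
  simp only [sub_apply, sum_apply, add_apply, smul_apply, ContinuousLinearMap.comp_apply,
    ContinuousLinearMap.coe_fst', ContinuousLinearMap.coe_snd', smul_eq_mul,
    Finset.sum_add_distrib, mul_add, Finset.mul_sum]
  have h3 : ∑ k ∈ Finset.range (m + 1), a k y * (r⁻¹ * (2 * k * r ^ (2 * k)) * t)
      = ∑ k ∈ Finset.range (m + 1), t * r⁻¹ * (2 * k * r ^ (2 * k) * a k y) :=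
    Finset.sum_congr rfl fun k _ => by ring
  rw [h3]
  ring

/-- `φ = ∑_{k ≤ m} r^{2k} a_k + r^{2m} log r · ℓ + o(r^{2m})` at `y`, where the expansion may be
differentiated once. -/
structure HasLogExpansion (m : ℕ) (y : V) (φ : V × ℝ → ℝ) (a : ℕ → V → ℝ) (ℓ : V → ℝ) : Prop where
  diff : ∀ᶠ r in 𝓝[>] 0, DifferentiableAt ℝ φ (y, r)
  coeff_diff : ∀ k ≤ m, DifferentiableAt ℝ (a k) y
  log_diff : DifferentiableAt ℝ ℓ y
  remainder : (fun r => expansionRemainder (2 * m) φ a ℓ (y, r))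
    =o[𝓝[>] 0] fun r : ℝ => r ^ (2 * m)
  remainder_fderiv : (fun r => fderiv ℝ (expansionRemainder (2 * m) φ a ℓ) (y, r))
    =o[𝓝[>] 0] fun r : ℝ => r ^ (2 * m - 1)

theorem HasLogExpansion.remainder_fderiv_apply (h : HasLogExpansion m y φ a ℓ) (w : V × ℝ) :
    (fun r => fderiv ℝ (expansionRemainder (2 * m) φ a ℓ) (y, r) w)
      =o[𝓝[>] 0] fun r : ℝ => r ^ (2 * m - 1) :=
  ((ContinuousLinearMap.apply ℝ ℝ w).isBigO_comp _ _).trans_isLittleO h.remainder_fderiv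

theorem hasEvenJet_sum_pow (m N : ℕ) (c : ℕ → ℝ) :
    HasEvenJet m (fun r : ℝ => ∑ k ∈ Finset.range N, r ^ (2 * k) * c k)
      (∑ k ∈ Finset.range N, C (c k) * X ^ k) := by
  refine HasEvenJet.sum _ fun k _ => ?_
  have := HasEvenJet.of_eval m (C (c k) * X ^ k)
  refine this.congr' (Eventually.of_forall fun r => ?_)
  simp only [eval_mul, eval_C, eval_pow, eval_X, RCLike.ofReal_real_eq_id, id]
  rw [pow_mul]
  ring

/-- Both `r^{2m} log r` and the derivative of the remainder are `o(r^{2m-1})`, hence invisible at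
order `r^{2m-2}`. -/
theorem HasLogExpansion.hasSpatialJet (h : HasLogExpansion m y φ a ℓ) (hm : 1 ≤ m) :
    HasSpatialJet (m - 1) y φ := by
  have hlog : ∀ c, HasEvenJet (m - 1) (fun r => powLog m r * c) (0 * C c) := fun c =>
    (HasEvenJet.of_isLittleO ((isLittleO_powLog hm).trans_isBigO
      (isBigO_pow_pow_nhdsGT (by omega)))).mul (HasEvenJet.const _ c)
  refine ⟨h.diff, ⟨_, (((HasEvenJet.of_isLittleO h.remainder).mono (Nat.sub_le m 1)).add
    ((hasEvenJet_sum_pow _ (m + 1) fun k => a k y).add (hlog (ℓ y)))).congr'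
      (Eventually.of_forall fun r => ?_)⟩, fun v => ?_⟩
  · simp [expansionRemainder, powLog]
  · have h2 : HasEvenJet (m - 1)
        (fun r => fderiv ℝ (expansionRemainder (2 * m) φ a ℓ) (y, r) (v, 0)) 0 := by
      refine HasEvenJet.of_isLittleO ((h.remainder_fderiv_apply _).trans_isBigO
        (isBigO_pow_pow_nhdsGT (by omega)))
    refine ⟨_, (h2.add ((hasEvenJet_sum_pow _ (m + 1) fun k => fderiv ℝ (a k) y v).add
      (hlog (fderiv ℝ ℓ y v)))).congr' ?_⟩
    filter_upwards [h.diff, self_mem_nhdsWithin] with r hr hpos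
    rw [hasFDerivAt_expansionRemainder hpos hr h.coeff_diff h.log_diff]
    ring

/-- The factor `r` in the Euler derivative restores the order that differentiating the remainder
loses. -/
theorem HasLogExpansion.hasLogJet (h : HasLogExpansion m y φ a ℓ) (hm : 1 ≤ m) :
    HasLogJet m (fun r => φ (y, r)) (∑ k ∈ Finset.range (m + 1), C (a k y) * X ^ k)
      (TrivSqZeroExt.inl (a 0 y) + TrivSqZeroExt.inr (ℓ y)) where
  diff := by
    filter_upwards [h.diff] with r hr using (fderiv_apply_zero_one hr).differentiableAt
  val := by
    have := (HasEvenJet.of_isLittleO h.remainder).add (hasEvenJet_sum_pow m (m + 1) fun k => a k y)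
    rw [zero_add] at this
    refine this.congr' (Eventually.of_forall fun r => ?_)
    simp [expansionRemainder, powLog]
    ring
  der := by
    have h2 : HasEvenJet m
        (fun r => r * fderiv ℝ (expansionRemainder (2 * m) φ a ℓ) (y, r) (0, 1)) 0 := by
      refine HasEvenJet.of_isLittleO ?_
      refine ((isBigO_refl (fun r : ℝ => r) _).mul_isLittleO (h.remainder_fderiv_apply _)).congr_right fun r => ?_
      rw [← pow_succ']
      congr 1
      omega
    have h3 := h2.add (hasEvenJet_sum_pow m (m + 1) fun k => 2 * k * a k y)
    have hP : (2 * X * derivative (∑ k ∈ Finset.range (m + 1), C (a k y) * X ^ k) : ℝ[X])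
        = 0 + ∑ k ∈ Finset.range (m + 1), C (2 * k * a k y) * X ^ k := by
      rw [zero_add, derivative_sum, Finset.mul_sum]
      refine Finset.sum_congr rfl fun k _ => ?_
      rw [derivative_C_mul_X_pow]
      rcases Nat.eq_zero_or_pos k with rfl | hk
      · simp
      · conv_rhs => rw [show k = (k - 1) + 1 by omega, pow_succ]
        simp only [Nat.sub_add_cancel hk, map_mul, map_natCast, map_ofNat]
        ring
    rw [hP]
    refine h3.congr' ?_
    filter_upwards [h.diff, self_mem_nhdsWithin] with r hr hpos
    have hr0 : r ≠ 0 := ne_of_gt hpos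
    rw [(fderiv_apply_zero_one hr).deriv, hasFDerivAt_expansionRemainder hpos hr h.coeff_diff h.log_diff]
    have h4 : ∑ k ∈ Finset.range (m + 1), r ^ (2 * k) * (2 * k * a k y)
        = ∑ k ∈ Finset.range (m + 1), 2 * k * r ^ (2 * k) * a k y :=
      Finset.sum_congr rfl fun k _ => by ring
    simp only [h4, map_zero, mul_zero, Finset.sum_const_zero, TrivSqZeroExt.snd_add,
      TrivSqZeroExt.snd_inl, TrivSqZeroExt.snd_inr, one_mul, zero_add, add_zero]
    field_simp
    ring
  fst := by
    simp [finsetSum_coeff, coeff_X_pow, Finset.sum_range_succ']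

end ExpansionJets

/-! ### Passage from the manifold to charts. -/

section Charts

variable {n : ℕ} {M : Type*} [TopologicalSpace M] [ChartedSpace (EuclideanSpace ℝ (Fin n)) M]
  [IsManifold (𝓡 n) ∞ M] {e : OpenPartialHomeomorph M (EuclideanSpace ℝ (Fin n))}

theorem SmoothFunctions.contDiffOn_symm (f : SmoothFunctions n M)
    (he : e ∈ atlas (EuclideanSpace ℝ (Fin n)) M) :
    ContDiffOn ℝ ∞ (fun y => (f : M → ℂ) (e.symm y)) e.target := by
  have h1 := contMDiffOn_symm_of_mem_maximalAtlas (I := 𝓡 n) (n := ∞)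
    (IsManifold.subset_maximalAtlas he)
  have h2 : ContMDiff (𝓡 n) 𝓘(ℝ, ℂ) ∞ (f : M → ℂ) := f.2
  exact contMDiffOn_iff_contDiffOn.1 (h2.comp_contMDiffOn h1)

/-- The chart matrix is the Gram matrix of the pulled-back form, which stays positive definite
because the derivative of the inverse chart is injective. -/
theorem chartMatrix_det_pos (he : e ∈ atlas (EuclideanSpace ℝ (Fin n)) M) {h : CovTwoTensor n M}
    {y : EuclideanSpace ℝ (Fin n)} (hy : y ∈ e.target)
    (hsymm : ∀ v w, h (e.symm y) v w = h (e.symm y) w v)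
    (hpos : ∀ v, v ≠ 0 → 0 < h (e.symm y) v v) : 0 < (chartMatrix e h y).det := by
  have : IsManifold (𝓡 n) 1 M := IsManifold.of_le (n := ∞) (by simp)
  have hinj := (mdifferentiable_of_mem_atlas (I := 𝓡 n) he).symm.mfderiv_injective
    (x := y) (by simpa using hy)
  refine (Matrix.PosDef.of_dotProduct_mulVec_pos ?_ fun x hx => ?_).det_pos
  · ext i j
    simp [chartMatrix, hsymm]
  · set A := mfderiv (𝓡 n) (𝓡 n) e.symm y with hA
    let w : EuclideanSpace ℝ (Fin n) := ∑ i, x i • EuclideanSpace.single i (1 : ℝ)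
    have hw : w ≠ 0 := fun h0 => hx (funext fun i => by
      have := congrArg (fun v : EuclideanSpace ℝ (Fin n) => v i) h0
      simpa [w, Finset.sum_apply, Pi.single_apply] using this)
    have hAw : A w ≠ 0 := fun h0 => hw (hinj (h0.trans (map_zero A).symm))
    have hexp : star x ⬝ᵥ (chartMatrix e h y).mulVec x = h (e.symm y) (A w) (A w) := by
      have h1 : A w = ∑ i, x i • A (EuclideanSpace.single i (1 : ℝ)) := by
        exact (map_sum A _ _).trans (Finset.sum_congr rfl fun i _ => map_smul A _ _)
      rw [h1]
      simp only [map_sum, map_smul, sum_apply, smul_apply, dotProduct, Matrix.mulVec, chartMatrix,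
        Matrix.of_apply, smul_eq_mul, Finset.mul_sum]
      rw [Finset.sum_comm]
      refine Finset.sum_congr rfl fun i _ => Finset.sum_congr rfl fun j _ => ?_
      simp only [star_trivial, hA]
      ring
    rw [hexp]
    exact hpos _ hAw

variable {g : Bundle.ContMDiffRiemannianMetric (𝓡 n) ∞ (EuclideanSpace ℝ (Fin n))
  (TangentSpace (𝓡 n) : M → Type)} (P : PoincareEinsteinMetric g) {m : ℕ}
  {y : EuclideanSpace ℝ (Fin n)}

theorem PoincareEinsteinMetric.hasLogExpansion (hn : n = 2 * m) (hm : 1 ≤ m)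
    (he : e ∈ atlas (EuclideanSpace ℝ (Fin n)) M) (hy : y ∈ e.target) (i j : Fin n) :
    HasLogExpansion m y (fun q => chartMatrix e (P.metric q.2) q.1 i j)
      (fun k x => chartMatrix e (P.coeff k) x i j) (fun x => chartMatrix e P.logCoeff x i j) := by
  set φ : EuclideanSpace ℝ (Fin n) × ℝ → ℝ := fun q => chartMatrix e (P.metric q.2) q.1 i j
  set a : ℕ → EuclideanSpace ℝ (Fin n) → ℝ := fun k x => chartMatrix e (P.coeff k) x i j
  set ℓ : EuclideanSpace ℝ (Fin n) → ℝ := fun x => chartMatrix e P.logCoeff x i j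
  -- `n` also occurs in the types, so only the exponent is rewritten.
  have hrem : expansionRemainder n φ a ℓ = expansionRemainder (2 * m) φ a ℓ :=
    congrArg (fun d => expansionRemainder d φ a ℓ) hn
  -- The locally uniform estimates are restricted to the ray over `y`; only those for `k = 0` and `k
  -- = 1` are used.
  have hslice : Tendsto (fun r : ℝ => (y, r)) (𝓝[>] 0) (𝓝 y ×ˢ 𝓝[>] 0) :=
    tendsto_const_nhds.prodMk tendsto_id
  have hexp : ∀ k : ℕ, (fun r => iteratedFDeriv ℝ k (expansionRemainder n φ a ℓ) (y, r))
      =o[𝓝[>] 0] fun r : ℝ => r ^ ((n : ℤ) - k) := fun k =>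
    (P.expansion e he y hy i j k).comp_tendsto hslice
  rw [hrem] at hexp
  have hopen := e.open_target.mem_nhds hy
  refine ⟨?_, fun k hk => ?_, ?_, ?_, ?_⟩
  · filter_upwards [Ioo_mem_nhdsGT P.ε_pos] with r hr
    exact ((P.metric_smooth e he i j).differentiableOn (by simp)).differentiableAt
      ((e.open_target.prod isOpen_Ioo).mem_nhds ⟨hy, hr⟩)
  · exact ((P.coeff_smooth k (by omega) e he i j).differentiableOn (by simp)).differentiableAt hopen
  · exact ((P.logCoeff_smooth e he i j).differentiableOn (by simp)).differentiableAt hopen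
  · refine ((IsLittleO.norm_left (hexp 0)).congr (fun r => norm_iteratedFDeriv_zero) fun r => ?_
      ).of_norm_left
    rw [Nat.cast_zero, sub_zero, zpow_natCast, hn]
  · refine ((IsLittleO.norm_left (hexp 1)).congr (fun r => norm_iteratedFDeriv_one _) fun r => ?_
      ).of_norm_left
    rw [show (n : ℤ) - (1 : ℕ) = ((2 * m - 1 : ℕ) : ℤ) by omega, zpow_natCast]

theorem PoincareEinsteinMetric.hasMetricJet (hn : n = 2 * m) (hm : 1 ≤ m)
    (he : e ∈ atlas (EuclideanSpace ℝ (Fin n)) M) (hy : y ∈ e.target) :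
    HasMetricJet m y (fun q => chartMatrix e (P.metric q.2) q.1) (chartMatrix e g.inner y)
      (chartMatrix e P.logCoeff y) where
  spatial i j := (P.hasLogExpansion hn hm he hy i j).hasSpatialJet hm
  log i j := ⟨_, _, (P.hasLogExpansion hn hm he hy i j).hasLogJet hm, by
    simp [P.coeff_zero], by simp⟩
  det_pos := chartMatrix_det_pos he hy (fun v w => g.symm _ v w) fun v hv => g.pos _ v hv
  trace_eq_zero := P.logCoeff_traceFree e he y hy

end Charts

/-! ### Linearity of the Laplacian coefficients, and the fourth root of the determinant. -/

section LaplacianCoefficients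

variable {V : Type*} [NormedAddCommGroup V] [NormedSpace ℝ V]
variable {ι : Type*} [Fintype ι] [DecidableEq ι] {m : ℕ} {y : V} {b : ι → V}
  {H : V × ℝ → Matrix ι ι ℝ} {A : Matrix ι ι ℝ}

theorem LaplacianJet.laplacianCoeff_add (J : LaplacianJet m y b H A) (k : ℕ) {α β : V → ℂ}
    (hα : ContDiffAt ℝ 2 α y) (hβ : ContDiffAt ℝ 2 β y) :
    J.laplacianCoeff k (fun x => α x + β x) = J.laplacianCoeff k α + J.laplacianCoeff k β := by
  have hd : ∀ {α : V → ℂ}, ContDiffAt ℝ 2 α y → ∀ᶠ x in 𝓝 y, DifferentiableAt ℝ α x :=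
    fun hα => (hα.eventually (by simp)).mono fun x hx => hx.differentiableAt (by simp)
  have hd2 : ∀ {α : V → ℂ}, ContDiffAt ℝ 2 α y → ∀ v,
      DifferentiableAt ℝ (fun x => fderiv ℝ α x v) y := fun hα v =>
    ((hα.fderiv_right (m := 1) (by norm_num)).differentiableAt one_ne_zero).clm_apply
      (differentiableAt_const v)
  have h2 : ∀ v, (fun x => fderiv ℝ (fun x => α x + β x) x v) =ᶠ[𝓝 y]
      fun x => fderiv ℝ α x v + fderiv ℝ β x v := fun v => by
    filter_upwards [hd hα, hd hβ] with x h1 h2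
    rw [fderiv_fun_add h1 h2, add_apply]
  simp only [laplacianCoeff, ← Finset.sum_add_distrib, (h2 _).fderiv_eq, (h2 _).self_of_nhds,
    fderiv_fun_add (hd2 hα _) (hd2 hβ _), add_apply]
  exact Finset.sum_congr rfl fun i _ => Finset.sum_congr rfl fun j _ => by ring

theorem LaplacianJet.laplacianCoeff_const_mul (J : LaplacianJet m y b H A) (k : ℕ) (c : ℂ)
    {α : V → ℂ} (hα : ContDiffAt ℝ 2 α y) :
    J.laplacianCoeff k (fun x => c * α x) = c * J.laplacianCoeff k α := by
  have hd2 : ∀ v, DifferentiableAt ℝ (fun x => fderiv ℝ α x v) y := fun v =>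
    ((hα.fderiv_right (m := 1) (by norm_num)).differentiableAt one_ne_zero).clm_apply
      (differentiableAt_const v)
  have h2 : ∀ v, (fun x => fderiv ℝ (fun x => c * α x) x v) =ᶠ[𝓝 y]
      fun x => c * fderiv ℝ α x v := fun v => by
    filter_upwards [hα.eventually (by simp)] with x h1
    rw [fderiv_const_mul (h1.differentiableAt (by simp)), smul_apply, smul_eq_mul]
  simp only [laplacianCoeff, Finset.mul_sum, (h2 _).fderiv_eq, (h2 _).self_of_nhds,
    fderiv_const_mul (hd2 _), smul_apply, smul_eq_mul]
  exact Finset.sum_congr rfl fun i _ => Finset.sum_congr rfl fun j _ => by ring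

/-- The Taylor coefficients of `(det H / det A)^{-1/4}`. -/
theorem LaplacianJet.exists_fourth_root (J : LaplacianJet m y b H A) (hA : 0 < A.det) :
    ∃ Q : Polynomial ℝ, HasEvenJet m (fun r => ((H (y, r)).det / A.det) ^ (-(1 / 4) : ℝ)) Q ∧
      Q.coeff 0 = 1 ∧ ∀ N, 1 ≤ N → N ≤ m → 8 * (N : ℝ) * Q.coeff N
        = -∑ j ∈ Finset.range N, J.euler.coeff (N - j) * Q.coeff j := by
  have hφ : HasEvenJet m (fun r => (H (y, r)).det / A.det) (J.det * Polynomial.C (A.det)⁻¹) :=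
    J.det_jet.mul (.const m _)
  have hcoeff : (J.det * Polynomial.C (A.det)⁻¹).coeff 0 = 1 := by
    rw [Polynomial.coeff_mul_C, J.det_coeff_zero, mul_inv_cancel₀ hA.ne']
  have hlim : Tendsto (fun r => (H (y, r)).det / A.det) (𝓝[>] 0) (𝓝 1) := hcoeff ▸ hφ.tendsto
  obtain ⟨Q, hQ⟩ := exists_rpow_jet hφ hcoeff (-(1 / 4))
  refine ⟨Q, hQ, tendsto_nhds_unique hQ.tendsto ?_, fun N hN hNm =>
    coeff_recursion_of_fourth_root (P := J.det * Polynomial.C (A.det)⁻¹) ?_ ?_ hN hNm⟩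
  · simpa using hlim.rpow_const (p := (-(1 / 4) : ℝ)) (Or.inl one_ne_zero)
  · refine HasEvenJet.X_pow_dvd_sub ((hQ.pow 4).mul hφ) ?_
    rw [← Polynomial.C_1]
    refine (HasEvenJet.const m (1 : ℝ)).congr' ?_
    filter_upwards [hlim.eventually_const_lt one_pos] with r hr
    rw [← Real.rpow_natCast, ← Real.rpow_mul hr.le]
    norm_num
    rw [Real.rpow_neg_one, inv_mul_cancel₀ hr.ne']
  · have := J.euler_mul_det.mul_right (Polynomial.C (A.det)⁻¹)
    convert this using 1
    simp only [Polynomial.derivative_mul, Polynomial.derivative_C]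
    ring

end LaplacianCoefficients

/-! ### Point evaluations. -/

section Evaluation

variable (n : ℕ) {M : Type*} [TopologicalSpace M] [ChartedSpace (EuclideanSpace ℝ (Fin n)) M]

/-- Evaluation at a point, as a functional on smooth functions. -/
def evalAt (x : M) : SmoothFunctions n M →ₗ[ℂ] ℂ :=
  (LinearMap.proj x).comp (SmoothFunctions n M).subtype

theorem evalAt_apply (x : M) (f : SmoothFunctions n M) : evalAt n x f = (f : M → ℂ) x := rfl

end Evaluation

/-! ### The recursion on the manifold, and the volume function. -/

section Recursion

variable {n : ℕ} {M : Type*} [TopologicalSpace M] [ChartedSpace (EuclideanSpace ℝ (Fin n)) M]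
  [IsManifold (𝓡 n) ∞ M] {e : OpenPartialHomeomorph M (EuclideanSpace ℝ (Fin n))}
  {g : Bundle.ContMDiffRiemannianMetric (𝓡 n) ∞ (EuclideanSpace ℝ (Fin n))
    (TangentSpace (𝓡 n) : M → Type)} {m : ℕ} {y : EuclideanSpace ℝ (Fin n)}

/-- The coordinate frame of `ℝⁿ`. -/
noncomputable def coordinateFrame (n : ℕ) (i : Fin n) : EuclideanSpace ℝ (Fin n) :=
  EuclideanSpace.single i 1

/-- The coefficients of the expansion of the Laplacian of `g_r`, as functionals on smooth
functions. -/
noncomputable def laplacianFunctional {H : EuclideanSpace ℝ (Fin n) × ℝ → Matrix (Fin n) (Fin n) ℝ}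
    {A : Matrix (Fin n) (Fin n) ℝ} (J : LaplacianJet m y (coordinateFrame n) H A)
    (he : e ∈ atlas (EuclideanSpace ℝ (Fin n)) M) (hy : y ∈ e.target) (k : ℕ) :
    SmoothFunctions n M →ₗ[ℂ] ℂ where
  toFun f := J.laplacianCoeff k fun x => (f : M → ℂ) (e.symm x)
  map_add' f f' :=
    have h : ∀ f : SmoothFunctions n M, ContDiffAt ℝ 2 (fun x => (f : M → ℂ) (e.symm x)) y :=
      fun f => ((SmoothFunctions.contDiffOn_symm f he).contDiffAt (e.open_target.mem_nhds hy)).of_le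
        (WithTop.coe_le_coe.2 le_top)
    J.laplacianCoeff_add k (h f) (h f')
  map_smul' c f := J.laplacianCoeff_const_mul k c
    (((SmoothFunctions.contDiffOn_symm f he).contDiffAt (e.open_target.mem_nhds hy)).of_le
        (WithTop.coe_le_coe.2 le_top))

theorem PoincareEinsteinMetric.satisfiesRecursion (P : PoincareEinsteinMetric g) (hn : n = 2 * m)
    (hm : 1 ≤ m) {T : ℕ → ℂ → SmoothFunctions n M → SmoothFunctions n M}
    (hT : P.IsExpansionFamily T) (he : e ∈ atlas (EuclideanSpace ℝ (Fin n)) M) {x : M}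
    (hx : x ∈ e.source)
    (J : LaplacianJet m (e x) (coordinateFrame n) (fun q => chartMatrix e (P.metric q.2) q.1)
      (chartMatrix e g.inner (e x))) :
    SatisfiesRecursion ((n : ℂ) / 2) m T (evalAt n x) (fun k => (J.euler.coeff k : ℂ))
      (laplacianFunctional J he (e.map_source hx)) := by
  intro N _ hNm lam hlam f
  have hy := e.map_source hx
  have hu := hT.2 N (by omega) lam hlam f e he (e x) hy
  have hκ : (n : ℂ) / 2 = m := by rw [hn]; push_cast; ring
  have h := coeff_recursion_of_formal_solution J hm (by simpa using hn)
    (P.hasMetricJet hn hm he hy) hNm lam (α := fun j x => (T j lam f : M → ℂ) (e.symm x))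
    e.open_target hy (fun j => SmoothFunctions.contDiffOn_symm (T j lam f) he) (by
      rw [Fintype.card_fin]; exact hu)
  simp only [e.left_inv hx] at h
  rw [hκ]
  exact h

/-- `v` is the square root of the ratio of determinants, so `v^{-1/2}` is its power `-1/4`;
replacing `X` by `X²` in `Q` turns an expansion in `r²` into one in `r`. -/
theorem PoincareEinsteinMetric.isTaylorCoeff_volumeRatio (P : PoincareEinsteinMetric g)
    {x : M} {Q : Polynomial ℝ}
    (hdet : 0 < (chartMatrix (chartAt (EuclideanSpace ℝ (Fin n)) x) g.inner
      (chartAt (EuclideanSpace ℝ (Fin n)) x x)).det)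
    (hpos : ∀ᶠ r in 𝓝[>] 0, 0 < (chartMatrix (chartAt (EuclideanSpace ℝ (Fin n)) x) (P.metric r)
      (chartAt (EuclideanSpace ℝ (Fin n)) x x)).det)
    (hQ : HasEvenJet m (fun r => ((chartMatrix (chartAt (EuclideanSpace ℝ (Fin n)) x) (P.metric r)
      (chartAt (EuclideanSpace ℝ (Fin n)) x x)).det /
        (chartMatrix (chartAt (EuclideanSpace ℝ (Fin n)) x) g.inner
          (chartAt (EuclideanSpace ℝ (Fin n)) x x)).det) ^ (-(1 / 4) : ℝ)) Q) {N : ℕ} (hN : N ≤ m) :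
    IsTaylorCoeff (fun r => P.volumeRatio r x ^ (-(1 / 2) : ℝ)) (2 * N) (Q.coeff N) := by
  refine ⟨Polynomial.expand ℝ 2 Q, IsLittleO.congr' (hQ.mono hN) ?_ EventuallyEq.rfl, ?_⟩
  · filter_upwards [hpos] with r hr
    rw [volumeRatio, ← Real.sqrt_div hr.le, Real.sqrt_eq_rpow, ← Real.rpow_mul (by positivity),
      Polynomial.expand_eval]
    norm_num
  · rw [mul_comm, Polynomial.coeff_expand_mul two_pos]

end Recursion

end PoincareEinstein

/-! ### Assembly of the theorem. -/

theorem theorem4p2 (n : ℕ) (hn : 2 ≤ n) (hn_even : Even n)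
    (M : Type*) [TopologicalSpace M] [ChartedSpace (EuclideanSpace ℝ (Fin n)) M]
    [IsManifold (𝓡 n) ∞ M]
    (g : Bundle.ContMDiffRiemannianMetric (𝓡 n) ∞ (EuclideanSpace ℝ (Fin n))
      (TangentSpace (𝓡 n) : M → Type))
    (P : PoincareEinstein.PoincareEinsteinMetric g)
    (T : ℕ → ℂ → PoincareEinstein.SmoothFunctions n M → PoincareEinstein.SmoothFunctions n M)
    (hT : P.IsExpansionFamily T)
    (N : ℕ) (hN : 2 * N ≤ n) :
    ∃ (p : Polynomial (Module.End ℂ (PoincareEinstein.SmoothFunctions n M))) (w : M → ℝ),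
      p.degree ≤ N ∧
      (∀ lam : ℂ, PoincareEinstein.IsRegularParameter n N lam →
        ∀ f : PoincareEinstein.SmoothFunctions n M,
          (∏ j ∈ Finset.Icc 1 N, (lam - (n : ℂ) / 2 + j)) • T N lam f
            = p.eval (algebraMap ℂ _ lam) f) ∧
      (∀ x : M, PoincareEinstein.IsTaylorCoeff
        (fun r => P.volumeRatio r x ^ (-(1 / 2) : ℝ)) (2 * N) (w x)) ∧
      ∀ (f : PoincareEinstein.SmoothFunctions n M) (x : M),
        (p.coeff N f : M → ℂ) x = (w x : ℂ) * (f : M → ℂ) x := by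
  open PoincareEinstein in
  obtain ⟨m, hm2⟩ := hn_even
  have hnm : n = 2 * m := by omega
  have hm : 1 ≤ m := by omega
  have hsrc : ∀ x : M, x ∈ (chartAt (EuclideanSpace ℝ (Fin n)) x).source := mem_chart_source _
  have htgt : ∀ x : M, chartAt (EuclideanSpace ℝ (Fin n)) x x
      ∈ (chartAt (EuclideanSpace ℝ (Fin n)) x).target := mem_chart_target _
  have hat : ∀ x : M, chartAt (EuclideanSpace ℝ (Fin n)) x
      ∈ atlas (EuclideanSpace ℝ (Fin n)) M := chart_mem_atlas _
  have hjet := fun x : M => P.hasMetricJet hnm hm (hat x) (htgt x)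
  have J := fun x : M => ((hjet x).nonempty_laplacianJet hm (coordinateFrame n)).some
  have hrec := fun x : M => P.satisfiesRecursion hnm hm hT (hat x) (hsrc x) (J x)
  obtain ⟨p, hp⟩ := exists_operatorPolynomial (ev := evalAt n (M := M))
    (fun s t h => Subtype.ext (funext h)) hT.1 hrec
  choose Q hQ hQ0 hQrec using fun x => (J x).exists_fourth_root (hjet x).det_pos
  -- The leading coefficients applied to `f` and the Taylor coefficients of `(det g_r / det
  -- g)^{-1/4}` times `f(x)` obey the same recursion with the same initial value, so strong
  -- induction identifies them.
  have hlead : ∀ k ≤ m, ∀ x f,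
      evalAt n x ((p k).coeff k f) = ((Q x).coeff k : ℂ) * (f : M → ℂ) x := by
    intro k hk
    induction k using Nat.strong_induction_on with
    | _ k ih =>
    intro x f
    rcases Nat.eq_zero_or_pos k with rfl | hpos
    · rw [(hp 0 hk).2.2.1 rfl, hQ0, evalAt_apply, Complex.ofReal_one, one_mul]
    · have hk0 : (8 * k : ℂ) ≠ 0 := mul_ne_zero (by norm_num) (by exact_mod_cast hpos.ne')
      refine mul_left_cancel₀ hk0 ?_
      have h2 : (8 * k : ℂ) * ((Q x).coeff k : ℂ)
          = -∑ j ∈ Finset.range k, ((J x).euler.coeff (k - j) : ℂ) * ((Q x).coeff j : ℂ) := by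
        exact_mod_cast congrArg Complex.ofReal (hQrec x k hpos hk)
      rw [(hp k hk).2.2.2 hpos, ← mul_assoc, h2, neg_mul, Finset.sum_mul]
      refine congrArg _ (Finset.sum_congr rfl fun j hj => ?_)
      have hj := Finset.mem_range.1 hj
      rw [ih j hj (by omega), mul_assoc]
  have hNm : N ≤ m := by omega
  refine ⟨p N, fun x => (Q x).coeff N, Polynomial.degree_le_of_natDegree_le (hp N hNm).1,
    (hp N hNm).2.1, fun x => ?_, fun f x => hlead N hNm x f⟩
  refine P.isTaylorCoeff_volumeRatio (hjet x).det_pos ?_ (hQ x) hNm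
  exact Tendsto.eventually_const_lt (hjet x).det_pos
    ((J x).det_coeff_zero ▸ (J x).det_jet.tendsto)
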